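/- Let $K$ be an arbitrary field, let $\Lambda=\Lambda(x_i\mid i\ge 0)$ be the Grassmann algebra over $K$ in countably many odd letters, and let $\partial_i$ be the odd superderivation of $\Lambda$ with $\partial_i(x_j)=\delta_{ij}$. Regard $\operatorname{End}_K\Lambda$ as a Lie superalgebra under the supercommutator $[\varphi,\psi]=\varphi\psi-(-1)^{\deg\varphi\deg\psi}\psi\varphi$, with, if $\operatorname{char}K=2$, the additional quadratic mapping $\varphi\mapsto\varphi^2$ on odd elements; in characteristic $2$ all subalgebras and ideals are also required to be closed under this mapping (applied to their odd elements). Identify $x_i$ with left multiplication by $x_i$, and let $$v_i=\partial_i+x_ix_{i+1}\bigl(\partial_{i+2}+x_{i+2}x_{i+3}(\partial_{i+4}+x_{i+4}x_{i+5}(\partial_{i+6}+\cdots))\bigr),\qquad i\ge 0,$$ be the pivot superderivations of $\Lambda$. Let $R=\mathrm{Lie}(v_0,v_1)\subset\operatorname{End}_K\Lambda$ be the Lie superalgebra generated by $v_0$ and $v_1$. Then $R$ is just infinite: $\dim_K R=\infty$, and every nonzero (two-sided, not necessarily $\mathbb Z_2$-graded) ideal of $R$ has finite codimension in $R$. Moreover,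 call the following elements basis monomials of length $n$, where $r_m$ denotes any product $x_0^{\xi_0}\cdots x_m^{\xi_m}$ with $\xi_i\in\{0,1\}$, and $r_m=1$ if $m<0$: the elements $r_{n-2}v_n$ for $n\ge 0$; and, for $n\ge 2$, the elements $r_{n-3}x_{n-1}v_n$ other than $x_0x_2v_3$ if $\operatorname{char}K\ne 2$, but only the element $x_{n-1}v_n$ if $\operatorname{char}K=2$. Then for every nonzero ideal $J$ of $R$ there is an integer $N\ge 0$ such that $J$ contains all basis monomials of length at least $N+6$. -/

import Mathlib

/-- The Grassmann algebra `Λ = Λ(x_i ∣ i ≥ 0)` over `K`. -/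
abbrev GrassmannAlg (K : Type*) [Field K] : Type _ :=
  ExteriorAlgebra K (ℕ →₀ K)

namespace GrassmannAlg

/-- The Grassmann letter `x_i` as an element of `Λ`. -/
noncomputable def letter (K : Type*) [Field K] (i : ℕ) : GrassmannAlg K :=
  ExteriorAlgebra.ι K (Finsupp.single i (1 : K))

/-- The monomial `x_{i_1} ⋯ x_{i_t}`, where `S = {i_1 < ⋯ < i_t}`. -/
noncomputable def monomial (K : Type*) [Field K] (S : Finset ℕ) : GrassmannAlg K :=
  ((S.sort (· ≤ ·)).map (letter K)).prod

/-- The left superderivative `∂_i` of `Λ`, i.e. the odd superderivation with `∂_i (x_j) = δ_ij`. -/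
noncomputable def partialD (K : Type*) [Field K] (i : ℕ) : Module.End K (GrassmannAlg K) :=
  CliffordAlgebra.contractLeft (Finsupp.lapply i : (ℕ →₀ K) →ₗ[K] K)

/-- The `ℤ/2`-grading `Λ = Λ_0 ⊕ Λ_1` in which all letters are odd. -/
noncomputable abbrev parity (K : Type*) [Field K] (i : ZMod 2) : Submodule K (GrassmannAlg K) :=
  CliffordAlgebra.evenOdd (0 : QuadraticForm K (ℕ →₀ K)) i

/-- The projection of `Λ` onto its component of parity `i`. -/
noncomputable def parityProj (K : Type*) [Field K] (i : ZMod 2) :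
    Module.End K (GrassmannAlg K) :=
  GradedAlgebra.proj (parity K) i

theorem finite_support_partialD {K : Type*} [Field K] (f : GrassmannAlg K) :
    (Function.support fun j => partialD K j f).Finite := by
  induction f using CliffordAlgebra.left_induction with
  | algebraMap r =>
    convert Set.finite_empty
    ext j
    simp [partialD]
  | add x y hx hy =>
    refine (hx.union hy).subset fun j hj => ?_
    by_contra hcon
    simp only [Set.mem_union, Function.mem_support, not_or, not_not] at hcon
    exact hj (by simp [hcon.1, hcon.2])
  | ι_mul x m hx =>
    refine (hx.union m.hasFiniteSupport).subset fun j hj => ?_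
    by_contra hcon
    simp only [Set.mem_union, Function.mem_support, not_or, not_not] at hcon
    refine hj ?_
    have h1 := hcon.1
    have h2 := hcon.2
    simp only [partialD] at h1 ⊢
    rw [CliffordAlgebra.contractLeft_ι_mul, h1]
    simp [h2]

/-- The infinite sum `∑_j c_j ∂_j` as an operator on `Λ`. It is well defined, since
each element of `Λ` is annihilated by almost all `∂_j`. -/
noncomputable def formalSum {K : Type*} [Field K] (c : ℕ → GrassmannAlg K) :
    Module.End K (GrassmannAlg K) where
  toFun f := ∑ᶠ j, c j * partialD K j f
  map_add' f g := by
    have hfin : ∀ h : GrassmannAlg K,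
        (Function.support fun j => c j * partialD K j h).Finite := fun h =>
      (finite_support_partialD h).subset fun j hj hcon => hj (by simp [hcon])
    rw [← finsum_add_distrib (hfin f) (hfin g)]
    simp [mul_add]
  map_smul' a f := by
    have hfin : (Function.support fun j => c j * partialD K j f).Finite :=
      (finite_support_partialD f).subset fun j hj hcon => hj (by simp [hcon])
    rw [RingHom.id_apply, smul_finsum' a hfin]
    simp

/-- The pivot element
`v_i = ∂_i + x_i x_{i+1} ∂_{i+2} + x_i x_{i+1} x_{i+2} x_{i+3} ∂_{i+4} + ⋯`
`= ∂_i + x_i x_{i+1} (∂_{i+2} + x_{i+2} x_{i+3} (∂_{i+4} + ⋯))`. -/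
noncomputable def pivot (K : Type*) [Field K] (i : ℕ) : Module.End K (GrassmannAlg K) :=
  formalSum fun j => if i ≤ j ∧ Even (j - i) then monomial K (Finset.Ico i j) else 0

/-- The component `End_i Λ` of the associative superalgebra `End Λ = End_0 Λ ⊕ End_1 Λ`. -/
noncomputable def endParity (K : Type*) [Field K] (i : ZMod 2) : Submodule K (Module.End K (GrassmannAlg K)) where
  carrier := {φ | ∀ j : ZMod 2, ∀ a ∈ parity K j, φ a ∈ parity K (i + j)}
  add_mem' hφ hψ j a ha := add_mem (hφ j a ha) (hψ j a ha)
  zero_mem' _ _ _ := zero_mem _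
  smul_mem' c _ hφ j a ha := Submodule.smul_mem _ c (hφ j a ha)

/-- The homogeneous component of parity `i` of an endomorphism of `Λ`. -/
noncomputable def endPart {K : Type*} [Field K] (i : ZMod 2) (φ : Module.End K (GrassmannAlg K)) :
    Module.End K (GrassmannAlg K) :=
  ∑ j : ZMod 2, parityProj K (i + j) * φ * parityProj K j

/-- The supercommutator on `End Λ`: the bilinear extension of
`[φ, ψ] = φ ψ - (-1) ^ (deg φ * deg ψ) ψ φ` from homogeneous to arbitrary elements. -/
noncomputable def superBracket {K : Type*} [Field K] (φ ψ : Module.End K (GrassmannAlg K)) :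
    Module.End K (GrassmannAlg K) :=
  ∑ i : ZMod 2, ∑ j : ZMod 2,
    (endPart i φ * endPart j ψ - (-1) ^ (i.val * j.val) * (endPart j ψ * endPart i φ))

/-- Lie sub-superalgebras of `End Λ`: graded subspaces that are closed under the supercommutator
and, in characteristic 2, under the quadratic mapping `φ ↦ φ²` on odd elements. -/
structure IsLieSubsuperalgebra {K : Type*} [Field K]
    (L : Submodule K (Module.End K (GrassmannAlg K))) : Prop where
  graded : ∀ i : ZMod 2, ∀ φ ∈ L, endPart i φ ∈ L
  bracket_mem : ∀ φ ∈ L, ∀ ψ ∈ L, superBracket φ ψ ∈ L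
  sq_mem : (2 : K) = 0 → ∀ φ ∈ L, φ ∈ endParity K 1 → φ * φ ∈ L

/-- `Lie(X)`, the smallest Lie sub-superalgebra containing `X`. -/
noncomputable def lieGenerated {K : Type*} [Field K] (X : Set (Module.End K (GrassmannAlg K))) :
    Submodule K (Module.End K (GrassmannAlg K)) :=
  sInf {L | IsLieSubsuperalgebra L ∧ X ⊆ L}

/-- `R = Lie(v_0, v_1)`. -/
noncomputable def pivotLie (K : Type*) [Field K] : Submodule K (Module.End K (GrassmannAlg K)) :=
  lieGenerated {pivot K 0, pivot K 1}

/-- `J` is a (two-sided, not necessarily graded) ideal of the Lie superalgebra `L`. In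
characteristic 2 ideals are also closed under the quadratic mapping on odd elements. -/
structure IsLieIdeal {K : Type*} [Field K]
    (L J : Submodule K (Module.End K (GrassmannAlg K))) : Prop where
  le : J ≤ L
  bracket_left_mem : ∀ φ ∈ L, ∀ ψ ∈ J, superBracket φ ψ ∈ J
  bracket_right_mem : ∀ φ ∈ L, ∀ ψ ∈ J, superBracket ψ φ ∈ J
  sq_mem : (2 : K) = 0 → ∀ ψ ∈ J, ψ ∈ endParity K 1 → ψ * ψ ∈ J

/-- The subspace `J` of `L` has finite codimension in `L`. -/
def HasFiniteCodim {K V : Type*} [Field K] [AddCommGroup V] [Module K V]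
    (L J : Submodule K V) : Prop :=
  FiniteDimensional K (L ⧸ J.submoduleOf L)

/-- `L` is just infinite: `dim L = ∞`, and each nonzero ideal of `L` has finite codimension. -/
def IsJustInfinite {K : Type*} [Field K]
    (L : Submodule K (Module.End K (GrassmannAlg K))) : Prop :=
  ¬ FiniteDimensional K L ∧
    ∀ J : Submodule K (Module.End K (GrassmannAlg K)), IsLieIdeal L J → J ≠ ⊥ →
      HasFiniteCodim L J

/-- The operator `x_S v_n`, where `x_S` acts by left multiplication. -/
noncomputable def monomialPivot (K : Type*) [Field K] (S : Finset ℕ) (n : ℕ) :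
    Module.End K (GrassmannAlg K) :=
  LinearMap.mulLeft K (monomial K S) * pivot K n

/-- The basis monomials of `R` of length `n`: the monomials `r_{n-2} v_n` of the first type, and
(for `n ≥ 2`) the monomials `r_{n-3} x_{n-1} v_n` other than `x_0 x_2 v_3`, where in characteristic
2 only `r_{n-3} = 1` is allowed. Here `r_m` is any monomial in `x_0, …, x_m`. -/
noncomputable def basisMonomials (K : Type*) [Field K] (n : ℕ) : Set (Module.End K (GrassmannAlg K)) :=
  {φ | ∃ S ⊆ Finset.range (n - 1), φ = monomialPivot K S n} ∪
  {φ | 2 ≤ n ∧ ∃ S ⊆ Finset.range (n - 2), ¬ (n = 3 ∧ S = {0}) ∧ ((2 : K) = 0 → S = ∅) ∧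
    φ = monomialPivot K (insert (n - 1) S) n}

end GrassmannAlg

namespace GrassmannAlg

/-! Everything rests on the recursion `v_n = ∂_n + x_n x_{n+1} v_{n+2}` and on the fact that `v_n`
kills any given element once `n` is large. Downward induction along the recursion shows that pivots
are odd superderivations and evaluates their anticommutators: `{v_n, v_m}` is `-x_n ⋯ x_{m-1}
v_{m+1}` for `m - n` odd and `2 x_n ⋯ x_{m-1} x_{m+1} v_{m+2}` for `m - n` even. Hence, for `n ≤ m`
and `f` in the first `n` letters, `[f v_n, g v_m] = f v_n(g) v_m + f α(g) {v_n, v_m}` with `α` the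
parity automorphism (`superBracket_coeffPivot`).

With this formula `R` is squeezed between two spans: it contains all `f v_n` with `f ∈ Λ(x_0, …,
x_{n-2})` (`coeffPivot_mem_pivotLie`) and lies in the span of these and the second type monomials
(`pivotLie_le_pivotSpan`). An exact basis is not needed, so `x_0 x_2 v_3` may stay in the upper
bound.

Let `a ≠ 0` lie in an ideal `J`, with `a(f) ≠ 0`. For large `p < m` the anticommutator term dies on
`f x_p`, so `[a, f x_p v_m] = a(f x_p) v_m` lies in `J`; its coefficient is nonzero because `x_p`
occurs in it with coefficient `a(f)`. Thus `h v_m ∈ J` with `h ≠ 0` for all large `m`. Choosing `g`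
with `h g = x_0 ⋯ x_{m-1}`, the bracket with `x_m g v_{m+2}` yields `x_0 ⋯ x_{m-1} v_{m+2} ∈ J`, and
brackets with `v_0, …, v_{m-1}` strip the letters, so `J` contains all pivots of large index
(`exists_pivot_mem`). From `v_n, v_{n+2} ∈ J` one recovers every basis monomial of length `n + 4`
(`coeffPivot_mem_of_mem_pivotCoeff`). What remains of the upper bound is finite dimensional, which
gives finite codimension. -/

variable {K : Type*} [Field K]

/-! ### Sign rules for letters and superderivatives -/

/-- The parity automorphism of `Λ`, acting as `(-1) ^ p` on the component of parity `p`. -/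
noncomputable def parityAut (K : Type*) [Field K] : GrassmannAlg K →ₐ[K] GrassmannAlg K :=
  CliffordAlgebra.involute

@[simp]
theorem parityAut_parityAut (f : GrassmannAlg K) : parityAut K (parityAut K f) = f :=
  CliffordAlgebra.involute_involute f

@[simp]
theorem parityAut_letter (i : ℕ) : parityAut K (letter K i) = -letter K i :=
  CliffordAlgebra.involute_ι _

theorem parityAut_injective : Function.Injective (parityAut K) :=
  Function.LeftInverse.injective (g := parityAut K) parityAut_parityAut

theorem ι_mul_eq (v : ℕ →₀ K) (f : GrassmannAlg K) :
    ExteriorAlgebra.ι K v * f = parityAut K f * ExteriorAlgebra.ι K v := by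
  induction f using CliffordAlgebra.left_induction with
  | algebraMap r =>
    rw [AlgHom.commutes]
    exact (Algebra.commutes r _).symm
  | add x y hx hy => rw [mul_add, map_add, add_mul, hx, hy]
  | ι_mul x m hx =>
    have h : ExteriorAlgebra.ι K v * CliffordAlgebra.ι 0 m =
        -(CliffordAlgebra.ι 0 m * ExteriorAlgebra.ι K v) :=
      eq_neg_of_add_eq_zero_left (ExteriorAlgebra.ι_add_mul_swap v m)
    have h' : parityAut K (CliffordAlgebra.ι 0 m) = -CliffordAlgebra.ι 0 m :=
      CliffordAlgebra.involute_ι _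
    rw [map_mul, h', ← mul_assoc, h, neg_mul, mul_assoc, hx, neg_mul, neg_mul, mul_assoc]

theorem letter_mul_eq (i : ℕ) (f : GrassmannAlg K) :
    letter K i * f = parityAut K f * letter K i :=
  ι_mul_eq _ f

theorem mul_letter_eq (i : ℕ) (f : GrassmannAlg K) :
    f * letter K i = letter K i * parityAut K f := by
  rw [letter_mul_eq, parityAut_parityAut]

@[simp]
theorem letter_mul_self (i : ℕ) : letter K i * letter K i = 0 :=
  ExteriorAlgebra.ι_sq_zero _

@[simp]
theorem letter_mul_letter_mul_self (i : ℕ) (f : GrassmannAlg K) :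
    letter K i * (letter K i * f) = 0 := by
  rw [← mul_assoc, letter_mul_self, zero_mul]

theorem letter_mul_mul_letter (i : ℕ) (f : GrassmannAlg K) :
    letter K i * f * letter K i = 0 := by
  rw [mul_assoc, mul_letter_eq, letter_mul_letter_mul_self]

theorem letter_mul_mul_letter_mul (i : ℕ) (f g : GrassmannAlg K) :
    letter K i * (f * (letter K i * g)) = 0 := by
  rw [← mul_assoc f, mul_letter_eq, mul_assoc, letter_mul_letter_mul_self]

theorem letter_mul_letter_commute (i j : ℕ) (f : GrassmannAlg K) :
    letter K i * letter K j * f = f * (letter K i * letter K j) := by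
  rw [mul_assoc, letter_mul_eq j, ← mul_assoc, letter_mul_eq i, parityAut_parityAut, mul_assoc]

theorem partialD_letter_mul (i j : ℕ) (f : GrassmannAlg K) :
    partialD K i (letter K j * f) =
      (if i = j then f else 0) - letter K j * partialD K i f := by
  unfold partialD letter
  refine (CliffordAlgebra.contractLeft_ι_mul _ _ _).trans ?_
  congr 1
  rw [Finsupp.lapply_apply, Finsupp.single_apply]
  split_ifs with h1 h2 h2
  · exact one_smul K f
  · exact absurd h1.symm h2
  · exact absurd h2.symm h1
  · exact zero_smul K f

@[simp]
theorem partialD_one (i : ℕ) : partialD K i 1 = 0 :=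
  CliffordAlgebra.contractLeft_one _ _

theorem partialD_letter (i j : ℕ) :
    partialD K i (letter K j) = if i = j then 1 else 0 := by
  simpa using partialD_letter_mul i j (1 : GrassmannAlg K)

theorem partialD_mul (i : ℕ) (f g : GrassmannAlg K) :
    partialD K i (f * g) = partialD K i f * g + parityAut K f * partialD K i g := by
  induction f using CliffordAlgebra.left_induction with
  | algebraMap r =>
    have h : partialD K i (algebraMap K _ r) = 0 := CliffordAlgebra.contractLeft_algebraMap _ _ _
    rw [h, AlgHom.commutes, zero_mul, zero_add, ← Algebra.smul_def, map_smul, Algebra.smul_def]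
  | add x y hx hy => simp only [add_mul, map_add, hx, hy]; abel
  | ι_mul x m hx =>
    have h (z : GrassmannAlg K) : partialD K i (CliffordAlgebra.ι 0 m * z) =
        m i • z - CliffordAlgebra.ι 0 m * partialD K i z :=
      CliffordAlgebra.contractLeft_ι_mul _ _ _
    have h' : parityAut K (CliffordAlgebra.ι 0 m) = -CliffordAlgebra.ι 0 m :=
      CliffordAlgebra.involute_ι _
    rw [mul_assoc, h, h, hx, map_mul, h', sub_mul, mul_add, smul_mul_assoc]
    simp only [mul_assoc, neg_mul]
    abel

@[simp]
theorem partialD_partialD (i : ℕ) (f : GrassmannAlg K) : partialD K i (partialD K i f) = 0 :=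
  CliffordAlgebra.contractLeft_contractLeft _ _

theorem partialD_comm (i j : ℕ) (f : GrassmannAlg K) :
    partialD K i (partialD K j f) = -partialD K j (partialD K i f) :=
  CliffordAlgebra.contractLeft_comm _ _ _

/-! ### Monomials -/

@[simp]
theorem monomial_empty : monomial K ∅ = 1 := by
  simp [monomial]

theorem monomial_insert_min {a : ℕ} {S : Finset ℕ} (h : ∀ b ∈ S, a < b) :
    monomial K (insert a S) = letter K a * monomial K S := by
  rw [monomial, Finset.sort_insert (· ≤ ·) (fun b hb => (h b hb).le) fun ha => (h a ha).false]
  simp [monomial]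

theorem monomial_insert_max {a : ℕ} {S : Finset ℕ} (h : ∀ b ∈ S, b < a) :
    monomial K (insert a S) = monomial K S * letter K a := by
  have : (insert a S).sort (· ≤ ·) = S.sort (· ≤ ·) ++ [a] := by
    refine List.Perm.eq_of_pairwise' (r := (· ≤ ·)) (Finset.pairwise_sort _ _) ?_ ?_
    · refine List.pairwise_append.2 ⟨Finset.pairwise_sort _ _, by simp, ?_⟩
      intro x hx y hy
      rw [List.mem_singleton] at hy
      rw [Finset.mem_sort] at hx
      exact hy ▸ (h x hx).le
    · refine (List.perm_ext_iff_of_nodup (Finset.sort_nodup _ _) ?_).2 ?_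
      · refine List.nodup_append.2 ⟨Finset.sort_nodup _ _, by simp, ?_⟩
        intro x hx y hy
        rw [List.mem_singleton] at hy
        rw [Finset.mem_sort] at hx
        exact hy ▸ (h x hx).ne
      · intro x
        simp [or_comm]
  rw [monomial, this]
  simp [monomial]

theorem monomial_Ico_succ_left {n m : ℕ} (h : n < m) :
    monomial K (Finset.Ico n m) = letter K n * monomial K (Finset.Ico (n + 1) m) := by
  rw [← Finset.insert_Ico_add_one_left_eq_Ico h]
  exact monomial_insert_min fun b hb => (Finset.mem_Ico.1 hb).1

theorem monomial_Ico_succ_right {n m : ℕ} (h : n ≤ m) :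
    monomial K (Finset.Ico n (m + 1)) = monomial K (Finset.Ico n m) * letter K m := by
  rw [← Finset.insert_Ico_right_eq_Ico_add_one h]
  exact monomial_insert_max fun b hb => (Finset.mem_Ico.1 hb).2

/-! ### Pivot elements -/

/-- This recursion replaces the infinite sum in nearly all later arguments: every term after the
first begins with `x_n x_{n+1}`, and what follows is the sum for `n + 2`. -/
theorem pivot_apply (n : ℕ) (f : GrassmannAlg K) :
    pivot K n f = partialD K n f + letter K n * (letter K (n + 1) * pivot K (n + 2) f) := by
  have hs (c : ℕ → GrassmannAlg K) : (Function.support fun j => c j * partialD K j f).Finite :=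
    (finite_support_partialD f).subset fun j hj hcon => hj (by simp [hcon])
  have hs' (c : ℕ → GrassmannAlg K) (y : GrassmannAlg K) :
      (Function.support fun j => y * (c j * partialD K j f)).Finite :=
    (finite_support_partialD f).subset fun j hj hcon => hj (by simp [hcon])
  have h1 : partialD K n f = ∑ᶠ j, (if j = n then 1 else 0) * partialD K j f := by
    rw [finsum_eq_single _ n fun j hj => by simp [hj]]
    simp
  rw [← mul_assoc]
  change (∑ᶠ j, _) = _ + _ * (∑ᶠ j, _)
  rw [h1, mul_finsum' _ _ (hs _), ← finsum_add_distrib (hs _) (hs' _ _)]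
  refine finsum_congr fun j => ?_
  beta_reduce
  rw [← mul_assoc, ← add_mul]
  congr 1
  rcases lt_trichotomy j n with h | rfl | h
  · rw [if_neg (by omega), if_neg (by omega), if_neg (by omega), mul_zero, add_zero]
  · simp
  · rw [if_neg (show j ≠ n by omega), zero_add]
    by_cases he : Even (j - n)
    · obtain ⟨k, hk⟩ := he
      rw [if_pos ⟨by omega, k, hk⟩, if_pos ⟨by omega, k - 1, by omega⟩,
        monomial_Ico_succ_left h, monomial_Ico_succ_left (show n + 1 < j by omega), mul_assoc]
    · rw [if_neg fun hh => he hh.2, if_neg, mul_zero]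
      rintro ⟨hl, k, hk⟩
      exact he ⟨k + 1, by omega⟩

/-- Only finitely many `∂_j` act nontrivially on `f`. This supplies the base case of every downward
induction. -/
theorem exists_pivot_eq_zero (f : GrassmannAlg K) : ∃ N, ∀ n, N ≤ n → pivot K n f = 0 := by
  obtain ⟨N, hN⟩ := (finite_support_partialD f).bddAbove
  refine ⟨N + 1, fun n hn => finsum_eq_zero_of_forall_eq_zero fun j => ?_⟩
  by_cases hj : n ≤ j
  · have : partialD K j f = 0 := by
      by_contra hcon
      have := hN hcon
      omega
    rw [this, mul_zero]
  · beta_reduce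
    rw [if_neg fun h => hj h.1, zero_mul]

/-- Induction principle for statements on pivot elements: descend from large indices. -/
theorem pivot_descent {P : ℕ → Prop} (N : ℕ) (h : ∀ n, N ≤ n → P n) (hs : ∀ n, P (n + 2) → P n)
    (n : ℕ) : P n := by
  suffices H : ∀ k n, N ≤ n + k → P n from H N n (by omega)
  intro k
  induction k with
  | zero => exact fun n hn => h n hn
  | succ k ih => exact fun n hn => hs n (ih _ (by omega))

/-- The Leibniz rule passes from `v_{n+2}` to `v_n` because `x_n x_{n+1}` is even, hence central. -/
theorem pivot_mul (n : ℕ) (f g : GrassmannAlg K) :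
    pivot K n (f * g) = pivot K n f * g + parityAut K f * pivot K n g := by
  obtain ⟨N₁, h₁⟩ := exists_pivot_eq_zero f
  obtain ⟨N₂, h₂⟩ := exists_pivot_eq_zero g
  obtain ⟨N₃, h₃⟩ := exists_pivot_eq_zero (f * g)
  induction n using pivot_descent (max N₁ (max N₂ N₃)) with
  | h n hn =>
    rw [h₁ n (by omega), h₂ n (by omega), h₃ n (by omega)]
    simp
  | hs n ih =>
    rw [pivot_apply, ih, partialD_mul, pivot_apply n f, pivot_apply n g]
    have := letter_mul_letter_commute n (n + 1) (parityAut K f)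
    simp only [mul_add, add_mul, ← mul_assoc] at this ⊢
    rw [this]
    abel

/-- The coefficients of `v_n` are even and involve only letters of index at least `n`, so `∂_i` sees
only the `∂_j`. -/
theorem partialD_pivot {i n : ℕ} (h : i < n) (f : GrassmannAlg K) :
    partialD K i (pivot K n f) = -pivot K n (partialD K i f) := by
  obtain ⟨N₁, h₁⟩ := exists_pivot_eq_zero f
  obtain ⟨N₂, h₂⟩ := exists_pivot_eq_zero (partialD K i f)
  induction n using pivot_descent (max N₁ N₂) with
  | h n hn =>
    rw [h₁ n (by omega), h₂ n (by omega)]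
    simp
  | hs n ih =>
    rw [pivot_apply n f, pivot_apply n (partialD K i f), map_add, partialD_comm,
      partialD_letter_mul, if_neg (by omega), partialD_letter_mul, if_neg (by omega),
      ih (by omega)]
    simp only [zero_sub, mul_neg, neg_neg, neg_add]

@[simp]
theorem pivot_one (n : ℕ) : pivot K n 1 = 0 := by
  have := pivot_mul n (1 : GrassmannAlg K) 1
  simpa using this

theorem pivot_letter_of_lt {n k : ℕ} (h : k < n) : pivot K n (letter K k) = 0 := by
  obtain ⟨N, hN⟩ := exists_pivot_eq_zero (letter K k)
  induction n using pivot_descent N with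
  | h n hn => exact hN n hn
  | hs n ih =>
    rw [pivot_apply, ih (by omega), partialD_letter, if_neg (by omega)]
    simp

@[simp]
theorem pivot_letter_self (n : ℕ) : pivot K n (letter K n) = 1 := by
  rw [pivot_apply, pivot_letter_of_lt (by omega), partialD_letter, if_pos rfl]
  simp

theorem pivot_letter_mul_of_lt {n k : ℕ} (h : k < n) (f : GrassmannAlg K) :
    pivot K n (letter K k * f) = -(letter K k * pivot K n f) := by
  rw [pivot_mul, pivot_letter_of_lt h, parityAut_letter]
  simp

theorem pivot_letter_mul_self (n : ℕ) (f : GrassmannAlg K) :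
    pivot K n (letter K n * f) = f - letter K n * pivot K n f := by
  rw [pivot_mul, pivot_letter_self, parityAut_letter]
  simp [sub_eq_add_neg]

theorem letter_mul_pivot (n : ℕ) (f : GrassmannAlg K) :
    letter K n * pivot K n f = letter K n * partialD K n f := by
  rw [pivot_apply, mul_add, letter_mul_letter_mul_self, add_zero]

/-! ### Anticommutators of pivot elements -/

theorem pivot_pivot_self (n : ℕ) (f : GrassmannAlg K) :
    pivot K n (pivot K n f) = letter K (n + 1) * pivot K (n + 2) f := by
  rw [pivot_apply n (pivot K n f), pivot_apply n f, map_add, map_add, partialD_letter_mul,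
    if_pos rfl, partialD_letter_mul, if_neg (by omega), partialD_pivot (by omega),
    pivot_letter_mul_of_lt (by omega), pivot_letter_mul_of_lt (by omega)]
  simp [mul_add, letter_mul_mul_letter_mul]

/-- The anticommutator of two pivot elements, applied to `f`. -/
noncomputable def pivotAnticomm (n m : ℕ) : Module.End K (GrassmannAlg K) :=
  pivot K n * pivot K m + pivot K m * pivot K n

theorem pivotAnticomm_apply (n m : ℕ) (f : GrassmannAlg K) :
    pivotAnticomm n m f = pivot K n (pivot K m f) + pivot K m (pivot K n f) :=
  rfl

theorem pivotAnticomm_self (n : ℕ) (f : GrassmannAlg K) :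
    pivotAnticomm n n f = (2 : K) • (letter K (n + 1) * pivot K (n + 2) f) := by
  rw [pivotAnticomm_apply, pivot_pivot_self, two_smul]

theorem pivotAnticomm_of_lt {n m : ℕ} (h : n + 1 < m) (f : GrassmannAlg K) :
    pivotAnticomm n m f = letter K n * (letter K (n + 1) * pivotAnticomm (n + 2) m f) := by
  rw [pivotAnticomm_apply, pivot_apply n (pivot K m f), pivot_apply n f, map_add,
    partialD_pivot (by omega), pivot_letter_mul_of_lt (by omega), pivot_letter_mul_of_lt h,
    pivotAnticomm_apply]
  simp only [mul_add, mul_neg, neg_neg]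
  abel

/-- Expanding `{v_n, v_{n+1}}` produces the term `x_n x_{n+1} {v_{n+1}, v_{n+2}}`. This lemma, taken
at `n + 1`, removes it without knowing the next anticommutator. -/
theorem letter_mul_pivotAnticomm_succ (n : ℕ) (f : GrassmannAlg K) :
    letter K n * pivotAnticomm n (n + 1) f = 0 := by
  rw [pivotAnticomm_apply, mul_add, letter_mul_pivot, partialD_pivot (by omega),
    pivot_apply n f, map_add, pivot_letter_mul_of_lt (by omega)]
  simp [mul_add]

theorem pivotAnticomm_succ (n : ℕ) (f : GrassmannAlg K) :
    pivotAnticomm n (n + 1) f = -(letter K n * pivot K (n + 2) f) := by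
  have h := letter_mul_pivotAnticomm_succ (n + 1) f
  rw [pivotAnticomm_apply, mul_add] at h
  rw [pivotAnticomm_apply, pivot_apply n (pivot K (n + 1) f), pivot_apply n f, map_add,
    partialD_pivot (by omega), pivot_letter_mul_of_lt (by omega), pivot_letter_mul_self, mul_sub,
    eq_neg_of_add_eq_zero_right h]
  simp only [mul_neg]
  abel

theorem pivotAnticomm_odd (k n : ℕ) (f : GrassmannAlg K) :
    pivotAnticomm n (n + 2 * k + 1) f =
      -(monomial K (Finset.Ico n (n + 2 * k + 1)) * pivot K (n + 2 * k + 2) f) := by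
  induction k generalizing n with
  | zero => simp [pivotAnticomm_succ, monomial]
  | succ k ih =>
    rw [pivotAnticomm_of_lt (by omega), show n + 2 * (k + 1) = n + 2 + 2 * k by ring, ih,
      monomial_Ico_succ_left (show n < _ by omega),
      monomial_Ico_succ_left (show n + 1 < _ by omega)]
    simp [mul_assoc]

theorem pivotAnticomm_even (k n : ℕ) (f : GrassmannAlg K) :
    pivotAnticomm n (n + 2 * k) f =
      (2 : K) • (monomial K (Finset.Ico n (n + 2 * k)) *
        (letter K (n + 2 * k + 1) * pivot K (n + 2 * k + 2) f)) := by
  induction k generalizing n with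
  | zero => simp [pivotAnticomm_self]
  | succ k ih =>
    rw [pivotAnticomm_of_lt (by omega), show n + 2 * (k + 1) = n + 2 + 2 * k by ring, ih,
      monomial_Ico_succ_left (show n < _ by omega),
      monomial_Ico_succ_left (show n + 1 < _ by omega)]
    simp [mul_assoc]

/-! ### The subalgebras generated by the first `n` letters -/

/-- The subspace `Λ(x_0, …, x_{n-1})` of `Λ`. -/
noncomputable def below (K : Type*) [Field K] : ℕ → Submodule K (GrassmannAlg K)
  | 0 => 1
  | n + 1 => below K n ⊔ (below K n).map (LinearMap.mulRight K (letter K n))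

theorem mem_below_zero {f : GrassmannAlg K} : f ∈ below K 0 ↔ ∃ c : K, f = c • 1 := by
  rw [below, Submodule.mem_one]
  simp only [Algebra.algebraMap_eq_smul_one, eq_comm]

/-- The splitting `f = a + b x_n` by the last letter drives all inductions on the number of letters.
-/
theorem mem_below_succ {n : ℕ} {f : GrassmannAlg K} :
    f ∈ below K (n + 1) ↔ ∃ a ∈ below K n, ∃ b ∈ below K n, f = a + b * letter K n := by
  rw [below, Submodule.mem_sup]
  constructor
  · rintro ⟨a, ha, _, ⟨b, hb, rfl⟩, rfl⟩
    exact ⟨a, ha, b, hb, rfl⟩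
  · rintro ⟨a, ha, b, hb, rfl⟩
    exact ⟨a, ha, _, ⟨b, hb, rfl⟩, rfl⟩

theorem below_mono : Monotone (below K) :=
  monotone_nat_of_le_succ fun _ => le_sup_left

theorem below_le {n m : ℕ} (h : n ≤ m) {f : GrassmannAlg K} (hf : f ∈ below K n) :
    f ∈ below K m :=
  below_mono h hf

theorem one_mem_below (n : ℕ) : (1 : GrassmannAlg K) ∈ below K n :=
  below_le n.zero_le (mem_below_zero.2 ⟨1, (one_smul _ _).symm⟩)

theorem mul_letter_mem_below {n : ℕ} {f : GrassmannAlg K} (hf : f ∈ below K n) :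
    f * letter K n ∈ below K (n + 1) :=
  mem_below_succ.2 ⟨0, zero_mem _, f, hf, (zero_add _).symm⟩

theorem letter_mem_below {k n : ℕ} (h : k < n) : letter K k ∈ below K n := by
  refine below_le (show k + 1 ≤ n from h) ?_
  simpa using mul_letter_mem_below (one_mem_below (K := K) k)

instance below_finiteDimensional (n : ℕ) : FiniteDimensional K (below K n) := by
  induction n with
  | zero =>
    rw [below, Submodule.one_eq_span]
    infer_instance
  | succ n ih =>
    rw [below]
    infer_instance

theorem parityAut_mem_below {n : ℕ} {f : GrassmannAlg K} (hf : f ∈ below K n) :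
    parityAut K f ∈ below K n := by
  induction n generalizing f with
  | zero =>
    obtain ⟨c, rfl⟩ := mem_below_zero.1 hf
    rwa [map_smul, map_one]
  | succ n ih =>
    obtain ⟨a, ha, b, hb, rfl⟩ := mem_below_succ.1 hf
    exact mem_below_succ.2 ⟨_, ih ha, _, neg_mem (ih hb), by simp⟩

theorem mul_mem_below {n : ℕ} {f g : GrassmannAlg K} (hf : f ∈ below K n) (hg : g ∈ below K n) :
    f * g ∈ below K n := by
  induction n generalizing f g with
  | zero =>
    obtain ⟨c, rfl⟩ := mem_below_zero.1 hf
    simpa using Submodule.smul_mem _ c hg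
  | succ n ih =>
    obtain ⟨a, ha, b, hb, rfl⟩ := mem_below_succ.1 hf
    obtain ⟨c, hc, d, hd, rfl⟩ := mem_below_succ.1 hg
    refine mem_below_succ.2 ⟨_, ih ha hc, _,
      add_mem (ih ha hd) (ih hb (parityAut_mem_below hc)), ?_⟩
    rw [add_mul, mul_add, mul_add, mul_assoc b, letter_mul_eq n c, mul_assoc b,
      ← mul_assoc (letter K n), letter_mul_mul_letter, add_mul]
    simp only [mul_zero, add_zero, ← mul_assoc]
    abel

theorem letter_mul_mem_below {n : ℕ} {f : GrassmannAlg K} (hf : f ∈ below K n) :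
    letter K n * f ∈ below K (n + 1) :=
  mul_mem_below (letter_mem_below n.lt_succ_self) (below_le n.le_succ hf)

theorem exists_mem_below (f : GrassmannAlg K) : ∃ n, f ∈ below K n := by
  induction f using ExteriorAlgebra.induction with
  | algebraMap r =>
    exact ⟨0, mem_below_zero.2 ⟨r, Algebra.algebraMap_eq_smul_one r⟩⟩
  | ι v =>
    induction v using Finsupp.induction_linear with
    | zero => exact ⟨0, by simp⟩
    | add v w hv hw =>
      obtain ⟨a, ha⟩ := hv
      obtain ⟨b, hb⟩ := hw
      rw [map_add]
      exact ⟨max a b, add_mem (below_le (le_max_left _ _) ha) (below_le (le_max_right _ _) hb)⟩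
    | single i c =>
      refine ⟨i + 1, ?_⟩
      have : Finsupp.single i c = c • Finsupp.single i (1 : K) := by simp
      rw [this, map_smul]
      exact Submodule.smul_mem _ _ (letter_mem_below i.lt_succ_self)
  | mul x y hx hy =>
    obtain ⟨a, ha⟩ := hx
    obtain ⟨b, hb⟩ := hy
    exact ⟨max a b, mul_mem_below (below_le (le_max_left _ _) ha) (below_le (le_max_right _ _) hb)⟩
  | add x y hx hy =>
    obtain ⟨a, ha⟩ := hx
    obtain ⟨b, hb⟩ := hy
    exact ⟨max a b, add_mem (below_le (le_max_left _ _) ha) (below_le (le_max_right _ _) hb)⟩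

theorem partialD_eq_zero_of_mem_below {n i : ℕ} (h : n ≤ i) {f : GrassmannAlg K}
    (hf : f ∈ below K n) : partialD K i f = 0 := by
  induction n generalizing f with
  | zero =>
    obtain ⟨c, rfl⟩ := mem_below_zero.1 hf
    rw [map_smul, partialD_one, smul_zero]
  | succ n ih =>
    obtain ⟨a, ha, b, hb, rfl⟩ := mem_below_succ.1 hf
    rw [map_add, partialD_mul, ih (by omega) ha, ih (by omega) hb, partialD_letter,
      if_neg (by omega)]
    simp

theorem pivot_eq_zero_of_mem_below {n i : ℕ} (h : n ≤ i) {f : GrassmannAlg K}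
    (hf : f ∈ below K n) : pivot K i f = 0 := by
  induction n generalizing f with
  | zero =>
    obtain ⟨c, rfl⟩ := mem_below_zero.1 hf
    rw [map_smul, pivot_one, smul_zero]
  | succ n ih =>
    obtain ⟨a, ha, b, hb, rfl⟩ := mem_below_succ.1 hf
    rw [map_add, pivot_mul, ih (by omega) ha, ih (by omega) hb, pivot_letter_of_lt (by omega)]
    simp

theorem pivot_letter_mem_below (n k : ℕ) : pivot K n (letter K k) ∈ below K k := by
  obtain ⟨N, hN⟩ := exists_pivot_eq_zero (letter K k)
  induction n using pivot_descent N with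
  | h n hn =>
    rw [hN n hn]
    exact zero_mem _
  | hs n ih =>
    rw [pivot_apply, partialD_letter]
    refine add_mem ?_ ?_
    · split_ifs
      · exact one_mem_below _
      · exact zero_mem _
    · by_cases h : n + 2 ≤ k
      · exact mul_mem_below (letter_mem_below (by omega))
          (mul_mem_below (letter_mem_below (by omega)) ih)
      · rw [pivot_letter_of_lt (by omega)]
        simp

theorem pivot_mem_below (n : ℕ) {k : ℕ} {f : GrassmannAlg K} (hf : f ∈ below K k) :
    pivot K n f ∈ below K k := by
  induction k generalizing f with
  | zero =>
    rw [pivot_eq_zero_of_mem_below n.zero_le hf]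
    exact zero_mem _
  | succ k ih =>
    obtain ⟨a, ha, b, hb, rfl⟩ := mem_below_succ.1 hf
    rw [map_add, pivot_mul]
    exact add_mem (below_le k.le_succ (ih ha)) (add_mem (mul_letter_mem_below (ih hb))
      (below_le k.le_succ (mul_mem_below (parityAut_mem_below hb) (pivot_letter_mem_below _ _))))

theorem monomial_mem_below {n : ℕ} {S : Finset ℕ} (h : S ⊆ Finset.range n) :
    monomial K S ∈ below K n := by
  have (l : List ℕ) (hl : ∀ i ∈ l, i < n) : (l.map (letter K)).prod ∈ below K n := by
    induction l with
    | nil => exact one_mem_below n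
    | cons a l ih =>
      rw [List.map_cons, List.prod_cons]
      exact mul_mem_below (letter_mem_below (hl a (by simp))) (ih fun i hi => hl i (by simp [hi]))
  exact this _ fun i hi => Finset.mem_range.1 (h ((Finset.mem_sort _).1 hi))

theorem monomial_Ico_mem_below (n m : ℕ) : monomial K (Finset.Ico n m) ∈ below K m :=
  monomial_mem_below fun _ hi => Finset.mem_range.2 (Finset.mem_Ico.1 hi).2

/-- Every nonzero element of `Λ(x_0, …, x_{n-1})` divides the product `x_0 ⋯ x_{n-1}`. -/
theorem exists_mul_eq_monomial (n : ℕ) {h : GrassmannAlg K} (hh : h ∈ below K n) (h0 : h ≠ 0) :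
    ∃ g ∈ below K n, h * g = monomial K (Finset.Ico 0 n) := by
  induction n generalizing h with
  | zero =>
    obtain ⟨c, rfl⟩ := mem_below_zero.1 hh
    refine ⟨c⁻¹ • 1, mem_below_zero.2 ⟨_, rfl⟩, ?_⟩
    have hc : c ≠ 0 := by
      rintro rfl
      simp at h0
    simp [smul_smul, hc]
  | succ n ih =>
    obtain ⟨a, ha, b, hb, rfl⟩ := mem_below_succ.1 hh
    rw [monomial_Ico_succ_right n.zero_le]
    by_cases ha0 : a = 0
    -- Here `h = b x_n`, and moving `x_n` past `α(g)` gives `b x_n α(g) = b g x_n`.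
    · subst ha0
      have hb0 : b ≠ 0 := by
        rintro rfl
        simp at h0
      obtain ⟨g, hg, hbg⟩ := ih hb hb0
      refine ⟨parityAut K g, below_le n.le_succ (parityAut_mem_below hg), ?_⟩
      rw [zero_add, mul_assoc, ← mul_letter_eq, ← mul_assoc, hbg]
    · obtain ⟨g, hg, hag⟩ := ih ha ha0
      -- The extra factor `x_n` annihilates the summand `b x_n`, leaving `a g x_n`.
      refine ⟨g * letter K n, mul_letter_mem_below hg, ?_⟩
      rw [add_mul, ← mul_assoc, hag, mul_assoc b, ← mul_assoc (letter K n), letter_mul_mul_letter,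
        mul_zero, add_zero]

/-! ### Parity -/

theorem parity_mul {p q : ZMod 2} {f g : GrassmannAlg K} (hf : f ∈ parity K p)
    (hg : g ∈ parity K q) : f * g ∈ parity K (p + q) :=
  SetLike.mul_mem_graded hf hg

theorem letter_mem_parity (i : ℕ) : letter K i ∈ parity K 1 :=
  CliffordAlgebra.ι_mem_evenOdd_one _ _

theorem one_mem_parity : (1 : GrassmannAlg K) ∈ parity K 0 :=
  SetLike.one_mem_graded _

theorem parityProj_mem (p : ZMod 2) (f : GrassmannAlg K) : parityProj K p f ∈ parity K p :=
  SetLike.coe_mem _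

theorem parityProj_of_mem {p q : ZMod 2} {f : GrassmannAlg K} (hf : f ∈ parity K q) :
    parityProj K p f = if p = q then f else 0 := by
  change (DirectSum.decompose (parity K) f p : GrassmannAlg K) = _
  split_ifs with h
  · subst h
    exact DirectSum.decompose_of_mem_same _ hf
  · exact DirectSum.decompose_of_mem_ne _ hf (Ne.symm h)

theorem parityProj_add_parityProj (f : GrassmannAlg K) :
    parityProj K 0 f + parityProj K 1 f = f := by
  classical
  have := DirectSum.sum_support_decompose (parity K) f
  conv_rhs => rw [← this]
  rw [Finset.sum_subset (Finset.subset_univ _) fun i _ hi => by simpa using hi]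
  exact (Fin.sum_univ_two fun p : Fin 2 => parityProj K p f).symm

theorem sum_parityProj (f : GrassmannAlg K) : ∑ p, parityProj K p f = f :=
  (Fin.sum_univ_two fun p : Fin 2 => parityProj K p f).trans (parityProj_add_parityProj f)

theorem parityProj_mul_of_mem {p q : ZMod 2} {f g : GrassmannAlg K} (hg : g ∈ parity K q) :
    parityProj K (p + q) (f * g) = parityProj K p f * g :=
  DirectSum.coe_decompose_mul_add_of_right_mem (parity K) hg

theorem parityProj_mem_below (p : ZMod 2) {n : ℕ} {f : GrassmannAlg K} (hf : f ∈ below K n) :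
    parityProj K p f ∈ below K n := by
  induction n generalizing p f with
  | zero =>
    obtain ⟨c, rfl⟩ := mem_below_zero.1 hf
    rw [map_smul, parityProj_of_mem one_mem_parity]
    refine Submodule.smul_mem _ _ ?_
    split_ifs
    · exact one_mem_below 0
    · exact zero_mem _
  | succ n ih =>
    obtain ⟨a, ha, b, hb, rfl⟩ := mem_below_succ.1 hf
    have : parityProj K p (b * letter K n) = parityProj K (p - 1) b * letter K n := by
      rw [← parityProj_mul_of_mem (letter_mem_parity n), sub_add_cancel]
    rw [map_add, this]
    exact mem_below_succ.2 ⟨_, ih p ha, _, ih _ hb, rfl⟩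

theorem partialD_mem_parity (i : ℕ) {p : ZMod 2} {f : GrassmannAlg K} (hf : f ∈ parity K p) :
    partialD K i f ∈ parity K (1 + p) := by
  suffices H : ∀ n, ∀ f ∈ below K n, ∀ p, f ∈ parity K p → partialD K i f ∈ parity K (1 + p) by
    obtain ⟨n, hn⟩ := exists_mem_below f
    exact H n f hn p hf
  intro n
  induction n with
  | zero =>
    intro f hf p _
    rw [partialD_eq_zero_of_mem_below i.zero_le hf]
    exact zero_mem _
  | succ n ih =>
    intro f hf p hp
    obtain ⟨a, ha, b, hb, rfl⟩ := mem_below_succ.1 hf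
    -- Homogeneity of `a + b x_n` is not assumed to pass to `a` and `b`, so both are replaced by
    -- their homogeneous parts.
    have h1 : parityProj K p (b * letter K n) = parityProj K (p - 1) b * letter K n := by
      rw [← parityProj_mul_of_mem (letter_mem_parity n), sub_add_cancel]
    have h2 := parityProj_of_mem (p := p) hp
    rw [if_pos rfl, map_add, h1] at h2
    rw [← h2, map_add, partialD_mul, partialD_letter]
    have hb' := ih _ (parityProj_mem_below (p - 1) hb) _ (parityProj_mem _ _)
    refine add_mem (ih _ (parityProj_mem_below p ha) _ (parityProj_mem _ _)) (add_mem ?_ ?_)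
    · have := parity_mul hb' (letter_mem_parity n)
      rwa [add_assoc, sub_add_cancel] at this
    · have hα : parityAut K (parityProj K (p - 1) b) ∈ parity K (1 + p) := by
        have h3 : (1 : ZMod 2) + p = p - 1 := (by decide : ∀ p : ZMod 2, 1 + p = p - 1) p
        rw [h3]
        exact CliffordAlgebra.involute_mem_evenOdd_iff _ |>.2 (parityProj_mem _ _)
      split_ifs
      · rwa [mul_one]
      · rw [mul_zero]
        exact zero_mem _

theorem pivot_mem_parity (n : ℕ) {p : ZMod 2} {f : GrassmannAlg K} (hf : f ∈ parity K p) :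
    pivot K n f ∈ parity K (1 + p) := by
  obtain ⟨N, hN⟩ := exists_pivot_eq_zero f
  induction n using pivot_descent N with
  | h n hn =>
    rw [hN n hn]
    exact zero_mem _
  | hs n ih =>
    rw [pivot_apply]
    refine add_mem (partialD_mem_parity n hf) ?_
    have := parity_mul (letter_mem_parity n) (parity_mul (letter_mem_parity (n + 1)) ih)
    have h2 : (1 : ZMod 2) + (1 + (1 + p)) = 1 + p :=
      (by decide : ∀ p : ZMod 2, 1 + (1 + (1 + p)) = 1 + p) p
    rwa [h2] at this

theorem parityAut_of_even {f : GrassmannAlg K} (hf : f ∈ parity K 0) : parityAut K f = f :=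
  CliffordAlgebra.involute_eq_of_mem_even hf

theorem parityAut_of_odd {f : GrassmannAlg K} (hf : f ∈ parity K 1) : parityAut K f = -f :=
  CliffordAlgebra.involute_eq_of_mem_odd hf

theorem even_mul_comm {f : GrassmannAlg K} (hf : f ∈ parity K 0) (g : GrassmannAlg K) :
    f * g = g * f := by
  induction f, hf using CliffordAlgebra.even_induction with
  | algebraMap r => exact Algebra.commutes r g
  | add x y _ _ hx hy => rw [add_mul, mul_add, hx, hy]
  | ι_mul_ι_mul v w x _ hx =>
    have h1 := ι_mul_eq v (parityAut K g)
    rw [parityAut_parityAut] at h1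
    have h2 := ι_mul_eq w g
    change ExteriorAlgebra.ι K v * ExteriorAlgebra.ι K w * x * g =
      g * (ExteriorAlgebra.ι K v * ExteriorAlgebra.ι K w * x)
    rw [mul_assoc, hx, ← mul_assoc, mul_assoc _ _ g, h2, ← mul_assoc, h1]
    simp only [mul_assoc]

theorem odd_mul_comm {f : GrassmannAlg K} (hf : f ∈ parity K 1) (g : GrassmannAlg K) :
    f * g = parityAut K g * f := by
  induction f, hf using CliffordAlgebra.odd_induction with
  | ι v => exact ι_mul_eq v g
  | add x y _ _ hx hy => rw [add_mul, mul_add, hx, hy]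
  | ι_mul_ι_mul v w x _ hx =>
    have h1 := ι_mul_eq v g
    have h2 := ι_mul_eq w (parityAut K g)
    rw [parityAut_parityAut] at h2
    change ExteriorAlgebra.ι K v * ExteriorAlgebra.ι K w * x * g =
      parityAut K g * (ExteriorAlgebra.ι K v * ExteriorAlgebra.ι K w * x)
    rw [mul_assoc, hx, ← mul_assoc, mul_assoc _ _ (parityAut K g), h2, ← mul_assoc, h1]
    simp only [mul_assoc]

/-! ### The supercommutator -/

theorem mul_mem_endParity {i j : ZMod 2} {φ ψ : Module.End K (GrassmannAlg K)}
    (hφ : φ ∈ endParity K i) (hψ : ψ ∈ endParity K j) : φ * ψ ∈ endParity K (i + j) := by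
  intro k a ha
  rw [add_assoc]
  exact hφ _ _ (hψ k a ha)

theorem mulLeft_mem_endParity {p : ZMod 2} {f : GrassmannAlg K} (hf : f ∈ parity K p) :
    LinearMap.mulLeft K f ∈ endParity K p :=
  fun _ _ ha => parity_mul hf ha

theorem pivot_mem_endParity (n : ℕ) : pivot K n ∈ endParity K 1 :=
  fun _ _ ha => pivot_mem_parity n ha

theorem endPart_of_mem {a : ZMod 2} {φ : Module.End K (GrassmannAlg K)} (h : φ ∈ endParity K a)
    (i : ZMod 2) : endPart i φ = if i = a then φ else 0 := by
  refine LinearMap.ext fun f => ?_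
  have hj (j : ZMod 2) : parityProj K (i + j) (φ (parityProj K j f)) =
      if i = a then φ (parityProj K j f) else 0 := by
    rw [parityProj_of_mem (h j _ (parityProj_mem j f))]
    simp only [add_left_inj]
  simp only [endPart, LinearMap.sum_apply, Module.End.mul_apply, hj]
  split_ifs
  · rw [← map_sum, sum_parityProj]
  · simp

theorem endPart_add (i : ZMod 2) (φ ψ : Module.End K (GrassmannAlg K)) :
    endPart i (φ + ψ) = endPart i φ + endPart i ψ := by
  simp only [endPart, mul_add, add_mul, Finset.sum_add_distrib]

theorem endPart_smul (i : ZMod 2) (c : K) (φ : Module.End K (GrassmannAlg K)) :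
    endPart i (c • φ) = c • endPart i φ := by
  simp only [endPart, mul_smul_comm, smul_mul_assoc, Finset.smul_sum]

theorem superBracket_add_left (φ φ' ψ : Module.End K (GrassmannAlg K)) :
    superBracket (φ + φ') ψ = superBracket φ ψ + superBracket φ' ψ := by
  simp only [superBracket, endPart_add, ← Finset.sum_add_distrib]
  refine Finset.sum_congr rfl fun i _ => Finset.sum_congr rfl fun j _ => ?_
  simp only [mul_add, add_mul]
  abel

theorem superBracket_add_right (φ ψ ψ' : Module.End K (GrassmannAlg K)) :
    superBracket φ (ψ + ψ') = superBracket φ ψ + superBracket φ ψ' := by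
  simp only [superBracket, endPart_add, ← Finset.sum_add_distrib]
  refine Finset.sum_congr rfl fun i _ => Finset.sum_congr rfl fun j _ => ?_
  simp only [mul_add, add_mul]
  abel

theorem superBracket_smul_left (c : K) (φ ψ : Module.End K (GrassmannAlg K)) :
    superBracket (c • φ) ψ = c • superBracket φ ψ := by
  simp only [superBracket, endPart_smul, Finset.smul_sum]
  refine Finset.sum_congr rfl fun i _ => Finset.sum_congr rfl fun j _ => ?_
  simp only [mul_smul_comm, smul_mul_assoc, smul_sub]

theorem superBracket_smul_right (c : K) (φ ψ : Module.End K (GrassmannAlg K)) :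
    superBracket φ (c • ψ) = c • superBracket φ ψ := by
  simp only [superBracket, endPart_smul, Finset.smul_sum]
  refine Finset.sum_congr rfl fun i _ => Finset.sum_congr rfl fun j _ => ?_
  simp only [mul_smul_comm, smul_mul_assoc, smul_sub]

theorem superBracket_zero_left (ψ : Module.End K (GrassmannAlg K)) : superBracket 0 ψ = 0 := by
  simpa using superBracket_smul_left 0 0 ψ

theorem superBracket_zero_right (φ : Module.End K (GrassmannAlg K)) : superBracket φ 0 = 0 := by
  simpa using superBracket_smul_right 0 φ 0

theorem superBracket_of_mem {a b : ZMod 2} {φ ψ : Module.End K (GrassmannAlg K)}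
    (hφ : φ ∈ endParity K a) (hψ : ψ ∈ endParity K b) :
    superBracket φ ψ = φ * ψ - (-1) ^ (a.val * b.val) * (ψ * φ) := by
  rw [superBracket, Finset.sum_eq_single a, Finset.sum_eq_single b]
  · rw [endPart_of_mem hφ, endPart_of_mem hψ, if_pos rfl, if_pos rfl]
  · intro j _ hj
    rw [endPart_of_mem hψ, if_neg hj]
    simp
  · simp
  · intro i _ hi
    rw [endPart_of_mem hφ, if_neg hi]
    simp
  · simp

theorem superBracket_of_mem_of_mul_eq_zero {a b : ZMod 2} {φ ψ : Module.End K (GrassmannAlg K)}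
    (hφ : φ ∈ endParity K a) (hψ : ψ ∈ endParity K b) (hab : a * b = 0) :
    superBracket φ ψ = φ * ψ - ψ * φ := by
  have h : a.val * b.val = 0 := by
    exact (by decide : ∀ a b : ZMod 2, a * b = 0 → a.val * b.val = 0) a b hab
  rw [superBracket_of_mem hφ hψ, h, pow_zero, one_mul]

theorem superBracket_of_mem_odd {φ ψ : Module.End K (GrassmannAlg K)}
    (hφ : φ ∈ endParity K 1) (hψ : ψ ∈ endParity K 1) :
    superBracket φ ψ = φ * ψ + ψ * φ := by
  have h : (1 : ZMod 2).val * (1 : ZMod 2).val = 1 := rfl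
  have h' (χ : Module.End K (GrassmannAlg K)) : (-1) * χ = -χ := neg_one_mul χ
  rw [superBracket_of_mem hφ hψ, h, pow_one, h']
  exact sub_neg_eq_add _ _

theorem superBracket_swap {a b : ZMod 2} {φ ψ : Module.End K (GrassmannAlg K)}
    (hφ : φ ∈ endParity K a) (hψ : ψ ∈ endParity K b) :
    superBracket ψ φ = superBracket φ ψ ∨ superBracket ψ φ = -superBracket φ ψ := by
  by_cases hab : a * b = 0
  · right
    rw [superBracket_of_mem_of_mul_eq_zero hφ hψ hab,
      superBracket_of_mem_of_mul_eq_zero hψ hφ (by rw [mul_comm, hab])]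
    exact (neg_sub _ _).symm
  · left
    obtain ⟨rfl, rfl⟩ : a = 1 ∧ b = 1 :=
      (by decide : ∀ a b : ZMod 2, a * b ≠ 0 → a = 1 ∧ b = 1) a b hab
    rw [superBracket_of_mem_odd hφ hψ, superBracket_of_mem_odd hψ hφ, add_comm]

/-- The operator `f v_n`. -/
noncomputable def coeffPivot (f : GrassmannAlg K) (n : ℕ) : Module.End K (GrassmannAlg K) :=
  LinearMap.mulLeft K f * pivot K n

theorem coeffPivot_apply (f : GrassmannAlg K) (n : ℕ) (y : GrassmannAlg K) :
    coeffPivot f n y = f * pivot K n y :=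
  rfl

theorem monomialPivot_eq (S : Finset ℕ) (n : ℕ) :
    monomialPivot K S n = coeffPivot (monomial K S) n :=
  rfl

theorem coeffPivot_add (f g : GrassmannAlg K) (n : ℕ) :
    coeffPivot (f + g) n = coeffPivot f n + coeffPivot g n := by
  refine LinearMap.ext fun y => ?_
  simp only [coeffPivot_apply, LinearMap.add_apply, add_mul]

theorem coeffPivot_smul (c : K) (f : GrassmannAlg K) (n : ℕ) :
    coeffPivot (c • f) n = c • coeffPivot f n := by
  refine LinearMap.ext fun y => ?_
  simp only [coeffPivot_apply, LinearMap.smul_apply, smul_mul_assoc]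

@[simp]
theorem coeffPivot_one (n : ℕ) : coeffPivot 1 n = pivot K n := by
  refine LinearMap.ext fun y => ?_
  simp only [coeffPivot_apply, one_mul]

@[simp]
theorem coeffPivot_zero (n : ℕ) : coeffPivot (0 : GrassmannAlg K) n = 0 := by
  refine LinearMap.ext fun y => ?_
  simp only [coeffPivot_apply, zero_mul, LinearMap.zero_apply]

theorem coeffPivot_mem_endParity {p : ZMod 2} {f : GrassmannAlg K} (hf : f ∈ parity K p) (n : ℕ) :
    coeffPivot f n ∈ endParity K (p + 1) :=
  mul_mem_endParity (mulLeft_mem_endParity hf) (pivot_mem_endParity n)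

theorem superBracket_coeffPivot_of_mem_parity {p q : ZMod 2} {n m : ℕ} (hnm : n ≤ m)
    {f g : GrassmannAlg K} (hf : f ∈ below K n) (hfp : f ∈ parity K p) (hgq : g ∈ parity K q) :
    superBracket (coeffPivot f n) (coeffPivot g m) =
      coeffPivot (f * pivot K n g) m +
        LinearMap.mulLeft K (f * parityAut K g) * pivotAnticomm n m := by
  -- Since `f` has no letter from `x_m` on, `v_m(f) = 0`. This removes the other derivative term of
  -- the bracket in all four parity cases.
  have h0 := pivot_eq_zero_of_mem_below hnm hf
  have hφ := coeffPivot_mem_endParity hfp n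
  have hψ := coeffPivot_mem_endParity hgq m
  obtain rfl | rfl : p = 0 ∨ p = 1 := (by decide : ∀ p : ZMod 2, p = 0 ∨ p = 1) p <;>
  obtain rfl | rfl : q = 0 ∨ q = 1 := (by decide : ∀ p : ZMod 2, p = 0 ∨ p = 1) q
  · rw [superBracket_of_mem_odd hφ hψ]
    refine LinearMap.ext fun y => ?_
    simp only [LinearMap.add_apply, Module.End.mul_apply, coeffPivot_apply,
      LinearMap.mulLeft_apply, pivot_mul, h0, parityAut_of_even hfp, parityAut_of_even hgq,
      pivotAnticomm_apply, zero_mul, zero_add, mul_add]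
    rw [← mul_assoc g f, even_mul_comm hgq f]
    simp only [mul_assoc, add_assoc]
  · rw [superBracket_of_mem_of_mul_eq_zero hφ hψ rfl]
    refine LinearMap.ext fun y => ?_
    simp only [LinearMap.sub_apply, LinearMap.add_apply,
      Module.End.mul_apply, coeffPivot_apply, LinearMap.mulLeft_apply, pivot_mul, h0,
      parityAut_of_even hfp, parityAut_of_odd hgq, pivotAnticomm_apply, zero_mul, zero_add,
      mul_add]
    rw [← mul_assoc g f, ← even_mul_comm hfp]
    simp only [mul_assoc, neg_mul, mul_neg, sub_eq_add_neg]
    abel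
  · rw [superBracket_of_mem_of_mul_eq_zero hφ hψ rfl]
    refine LinearMap.ext fun y => ?_
    simp only [LinearMap.sub_apply, LinearMap.add_apply,
      Module.End.mul_apply, coeffPivot_apply, LinearMap.mulLeft_apply, pivot_mul, h0,
      parityAut_of_odd hfp, parityAut_of_even hgq, pivotAnticomm_apply, zero_mul, zero_add,
      mul_add]
    rw [← mul_assoc g, even_mul_comm hgq (-f)]
    simp only [mul_assoc, neg_mul, sub_eq_add_neg, neg_neg]
    abel
  · rw [superBracket_of_mem_of_mul_eq_zero hφ hψ rfl]
    refine LinearMap.ext fun y => ?_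
    simp only [LinearMap.sub_apply, LinearMap.add_apply,
      Module.End.mul_apply, coeffPivot_apply, LinearMap.mulLeft_apply, pivot_mul, h0,
      parityAut_of_odd hfp, parityAut_of_odd hgq, pivotAnticomm_apply, zero_mul, zero_add,
      mul_add]
    rw [← mul_assoc g, odd_mul_comm hgq, map_neg, parityAut_of_odd hfp]
    simp only [mul_assoc, neg_mul, mul_neg, sub_eq_add_neg, neg_neg]
    abel

/-- The bracket `[f v_n, g v_m] = f v_n(g) v_m + f α(g) {v_n, v_m}` for `n ≤ m`, `f` in the first
`n` letters. -/
theorem superBracket_coeffPivot {n m : ℕ} (hnm : n ≤ m) {f : GrassmannAlg K}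
    (hf : f ∈ below K n) (g : GrassmannAlg K) :
    superBracket (coeffPivot f n) (coeffPivot g m) =
      coeffPivot (f * pivot K n g) m +
        LinearMap.mulLeft K (f * parityAut K g) * pivotAnticomm n m := by
  have key (p q : ZMod 2) := superBracket_coeffPivot_of_mem_parity hnm
    (parityProj_mem_below p hf) (parityProj_mem p f) (parityProj_mem q g)
  have h1 := parityProj_add_parityProj f
  have h2 := parityProj_add_parityProj g
  have e : superBracket (coeffPivot f n) (coeffPivot g m) =
      superBracket (coeffPivot (parityProj K 0 f + parityProj K 1 f) n)
        (coeffPivot (parityProj K 0 g + parityProj K 1 g) m) := by rw [h1, h2]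
  rw [e]
  simp only [coeffPivot_add, superBracket_add_left, superBracket_add_right, key]
  refine LinearMap.ext fun y => ?_
  conv_rhs => rw [← h1, ← h2]
  simp only [LinearMap.add_apply, coeffPivot_apply, Module.End.mul_apply, LinearMap.mulLeft_apply,
    map_add, mul_add, add_mul]
  abel

theorem superBracket_pivot_coeffPivot {n m : ℕ} (hnm : n ≤ m) (g : GrassmannAlg K) :
    superBracket (pivot K n) (coeffPivot g m) =
      coeffPivot (pivot K n g) m + LinearMap.mulLeft K (parityAut K g) * pivotAnticomm n m := by
  simpa using superBracket_coeffPivot hnm (one_mem_below n) g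

theorem mulLeft_pivotAnticomm_odd (g : GrassmannAlg K) (k n : ℕ) :
    LinearMap.mulLeft K g * pivotAnticomm n (n + 2 * k + 1) =
      coeffPivot (-(g * monomial K (Finset.Ico n (n + 2 * k + 1)))) (n + 2 * k + 2) := by
  refine LinearMap.ext fun y => ?_
  simp only [Module.End.mul_apply, LinearMap.mulLeft_apply, pivotAnticomm_odd, coeffPivot_apply]
  simp [mul_assoc]

theorem mulLeft_pivotAnticomm_even (g : GrassmannAlg K) (k n : ℕ) :
    LinearMap.mulLeft K g * pivotAnticomm n (n + 2 * k) =
      coeffPivot ((2 : K) • (g * monomial K (Finset.Ico n (n + 2 * k)) * letter K (n + 2 * k + 1)))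
        (n + 2 * k + 2) := by
  refine LinearMap.ext fun y => ?_
  simp only [Module.End.mul_apply, LinearMap.mulLeft_apply, pivotAnticomm_even, coeffPivot_apply]
  simp [mul_assoc]

theorem letter_mul_monomial_Ico {i n m : ℕ} (hni : n ≤ i) (him : i < m) :
    letter K i * monomial K (Finset.Ico n m) = 0 := by
  induction m with
  | zero => omega
  | succ m ih =>
    rw [monomial_Ico_succ_right (by omega)]
    obtain h | rfl : i < m ∨ i = m := by omega
    · rw [← mul_assoc, ih h, zero_mul]
    · rw [← mul_assoc, letter_mul_mul_letter]

/-- Both closed forms of the anticommutator carry the factor `x_n ⋯ x_{m-1}`, which contains `x_i`.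
-/
theorem letter_mul_pivotAnticomm {i n m : ℕ} (hni : n ≤ i) (him : i < m)
    (f : GrassmannAlg K) : letter K i * pivotAnticomm n m f = 0 := by
  obtain ⟨k, rfl | rfl⟩ : ∃ k, m = n + 2 * k ∨ m = n + 2 * k + 1 := ⟨(m - n) / 2, by omega⟩
  · rw [pivotAnticomm_even, mul_smul_comm, ← mul_assoc, letter_mul_monomial_Ico hni him, zero_mul,
      smul_zero]
  · rw [pivotAnticomm_odd, mul_neg, ← mul_assoc, letter_mul_monomial_Ico hni him, zero_mul,
      neg_zero]

theorem mulLeft_mul_letter_pivotAnticomm {i n m : ℕ} (hni : n ≤ i) (him : i < m)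
    (g : GrassmannAlg K) : LinearMap.mulLeft K (g * letter K i) * pivotAnticomm n m = 0 := by
  refine LinearMap.ext fun y => ?_
  rw [Module.End.mul_apply, LinearMap.mulLeft_apply, mul_assoc, letter_mul_pivotAnticomm hni him,
    mul_zero, LinearMap.zero_apply]

/-- `[f v_n, g x_i v_m] = f v_n(g x_i) v_m` for `n ≤ i < m`. -/
theorem superBracket_coeffPivot_mul_letter {i n m : ℕ} (hni : n ≤ i) (him : i < m)
    {f : GrassmannAlg K} (hf : f ∈ below K n) (g : GrassmannAlg K) :
    superBracket (coeffPivot f n) (coeffPivot (g * letter K i) m) =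
      coeffPivot (f * pivot K n (g * letter K i)) m := by
  rw [superBracket_coeffPivot (by omega) hf, map_mul (parityAut K), parityAut_letter, mul_neg, ← neg_mul,
    ← mul_assoc, mulLeft_mul_letter_pivotAnticomm hni him, add_zero]

/-- `[f v_n, x_n g v_m] = f g v_m` for `n < m` and `g` free of `x_n`. -/
theorem superBracket_coeffPivot_letter_mul {n m : ℕ} (hnm : n < m) {f g : GrassmannAlg K}
    (hf : f ∈ below K n) (hg : partialD K n g = 0) :
    superBracket (coeffPivot f n) (coeffPivot (letter K n * g) m) = coeffPivot (f * g) m := by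
  rw [letter_mul_eq, superBracket_coeffPivot_mul_letter le_rfl hnm hf, ← letter_mul_eq,
    pivot_letter_mul_self, letter_mul_pivot, hg, mul_zero, sub_zero]

theorem superBracket_pivot_letter_mul {n m : ℕ} (hnm : n < m) {g : GrassmannAlg K}
    (hg : partialD K n g = 0) :
    superBracket (pivot K n) (coeffPivot (letter K n * g) m) = coeffPivot g m := by
  simpa using superBracket_coeffPivot_letter_mul hnm (one_mem_below n) hg

/-! ### The Lie superalgebra generated by the first two pivot elements -/

theorem isLieSubsuperalgebra_lieGenerated (X : Set (Module.End K (GrassmannAlg K))) :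
    IsLieSubsuperalgebra (lieGenerated X) where
  graded i φ hφ := by
    simp only [lieGenerated, Submodule.mem_sInf] at hφ ⊢
    exact fun L hL => hL.1.graded i φ (hφ L hL)
  bracket_mem φ hφ ψ hψ := by
    simp only [lieGenerated, Submodule.mem_sInf] at hφ hψ ⊢
    exact fun L hL => hL.1.bracket_mem φ (hφ L hL) ψ (hψ L hL)
  sq_mem h2 φ hφ h := by
    simp only [lieGenerated, Submodule.mem_sInf] at hφ ⊢
    exact fun L hL => hL.1.sq_mem h2 φ (hφ L hL) h

theorem subset_lieGenerated (X : Set (Module.End K (GrassmannAlg K))) :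
    X ⊆ lieGenerated X := by
  intro φ hφ
  simp only [lieGenerated, SetLike.mem_coe, Submodule.mem_sInf]
  exact fun L hL => hL.2 hφ

theorem pivot_mul_pivot (n : ℕ) : pivot K n * pivot K n = coeffPivot (letter K (n + 1)) (n + 2) :=
  LinearMap.ext fun y => pivot_pivot_self n y

theorem superBracket_pivot_self (n : ℕ) :
    superBracket (pivot K n) (pivot K n) = (2 : K) • coeffPivot (letter K (n + 1)) (n + 2) := by
  rw [superBracket_of_mem_odd (pivot_mem_endParity n) (pivot_mem_endParity n), pivot_mul_pivot,
    two_smul]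

/-- The bracket `[v_n, v_n]` only gives `2 v_n²`; in characteristic 2 the quadratic mapping takes
over. -/
theorem IsLieSubsuperalgebra.pivot_sq_mem {L : Submodule K (Module.End K (GrassmannAlg K))}
    (hL : IsLieSubsuperalgebra L) {n : ℕ} (hn : pivot K n ∈ L) :
    coeffPivot (letter K (n + 1)) (n + 2) ∈ L := by
  by_cases h2 : (2 : K) = 0
  · rw [← pivot_mul_pivot]
    exact hL.sq_mem h2 _ hn (pivot_mem_endParity n)
  · have := hL.bracket_mem _ hn _ hn
    rwa [superBracket_pivot_self, Submodule.smul_mem_iff _ h2] at this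

theorem pivot_mem_pivotLie (n : ℕ) : pivot K n ∈ pivotLie K := by
  have hL := isLieSubsuperalgebra_lieGenerated {pivot K 0, pivot K 1}
  have hs := subset_lieGenerated {pivot K 0, pivot K 1}
  suffices H : pivot K n ∈ pivotLie K ∧ pivot K (n + 1) ∈ pivotLie K from H.1
  induction n with
  | zero => exact ⟨hs (by simp), hs (by simp)⟩
  | succ n ih =>
    refine ⟨ih.2, ?_⟩
    -- The next pivot arises as `v_{n+2} = [v_{n+1}, v_n²]`, because `v_n² = x_{n+1} v_{n+2}`.
    have := hL.bracket_mem _ ih.2 _ (hL.pivot_sq_mem ih.1)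
    rw [← mul_one (letter K (n + 1)),
      superBracket_pivot_letter_mul (by omega) (partialD_one _), coeffPivot_one] at this
    exact this

theorem superBracket_pivot_coeffPivot_succ {n : ℕ} {g : GrassmannAlg K} (hg : g ∈ below K n) :
    superBracket (pivot K n) (coeffPivot g (n + 1)) =
      coeffPivot (-(parityAut K g * letter K n)) (n + 2) := by
  have := mulLeft_pivotAnticomm_odd (parityAut K g) 0 n
  simp only [mul_zero, add_zero] at this
  rw [superBracket_pivot_coeffPivot (by omega), pivot_eq_zero_of_mem_below le_rfl hg,
    coeffPivot_zero, zero_add, this, monomial_Ico_succ_left n.lt_succ_self]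
  simp

/-- Bracketing `v_n` with `g v_{n+1}` yields, up to sign, `α(g) x_n v_{n+2}`, and a second bracket
with `v_n` strips `x_n`. It is stated for a general subspace so as to serve both `R` and its ideals.
-/
theorem coeffPivot_mem_of_superBracket_mem {V : Submodule K (Module.End K (GrassmannAlg K))}
    {n : ℕ} (h : ∀ g ∈ below K n, superBracket (pivot K n) (coeffPivot g (n + 1)) ∈ V)
    (hV : ∀ φ ∈ V, superBracket (pivot K n) φ ∈ V) {f : GrassmannAlg K}
    (hf : f ∈ below K (n + 1)) : coeffPivot f (n + 2) ∈ V := by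
  have h1 : ∀ g ∈ below K n, coeffPivot (g * letter K n) (n + 2) ∈ V := by
    intro g hg
    have := h _ (neg_mem (parityAut_mem_below hg))
    rw [superBracket_pivot_coeffPivot_succ (neg_mem (parityAut_mem_below hg))] at this
    simpa using this
  have h2 : ∀ g ∈ below K n, coeffPivot g (n + 2) ∈ V := by
    intro g hg
    have := hV _ (h1 _ (parityAut_mem_below hg))
    rwa [← letter_mul_eq, superBracket_pivot_letter_mul (by omega)
      (partialD_eq_zero_of_mem_below le_rfl hg)] at this
  obtain ⟨a, ha, b, hb, rfl⟩ := mem_below_succ.1 hf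
  rw [coeffPivot_add]
  exact add_mem (h2 a ha) (h1 b hb)

theorem coeffPivot_mem_pivotLie {n : ℕ} {f : GrassmannAlg K} (hf : f ∈ below K (n - 1)) :
    coeffPivot f n ∈ pivotLie K := by
  have hL := isLieSubsuperalgebra_lieGenerated {pivot K 0, pivot K 1}
  have h0 (n : ℕ) {f : GrassmannAlg K} (hf : f ∈ below K 0) : coeffPivot f n ∈ pivotLie K := by
    obtain ⟨c, rfl⟩ := mem_below_zero.1 hf
    rw [coeffPivot_smul, coeffPivot_one]
    exact Submodule.smul_mem _ _ (pivot_mem_pivotLie n)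
  -- Truncated subtraction makes lengths 0 and 1 both the scalar case.
  cases n with
  | zero => exact h0 _ hf
  | succ n =>
    rw [Nat.add_sub_cancel] at hf
    induction n generalizing f with
    | zero => exact h0 _ hf
    | succ n ih =>
      exact coeffPivot_mem_of_superBracket_mem
        (fun g hg => hL.bracket_mem _ (pivot_mem_pivotLie n) _ (ih hg))
        (fun φ hφ => hL.bracket_mem _ (pivot_mem_pivotLie n) _ hφ) hf

/-! ### An upper bound for the Lie superalgebra -/

open Classical in
/-- The space of coefficients `b` for which `b x_{n+1} v_{n+2}` is a combination of basis monomials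
of the second type (with `x_0 x_2 v_3` included). -/
noncomputable def secondTypeCoeff (K : Type*) [Field K] (n : ℕ) : Submodule K (GrassmannAlg K) :=
  below K (if (2 : K) = 0 then 0 else n)

theorem secondTypeCoeff_le (n : ℕ) : secondTypeCoeff K n ≤ below K n := by
  rw [secondTypeCoeff]
  apply below_mono
  split_ifs <;> omega

/-- The space of coefficients `f` for which `f v_n` is a combination of basis monomials
(with `x_0 x_2 v_3` included). -/
noncomputable def pivotCoeff (K : Type*) [Field K] : ℕ → Submodule K (GrassmannAlg K)
  | 0 => below K 0
  | 1 => below K 0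
  | n + 2 => below K (n + 1) ⊔
      (secondTypeCoeff K n).map (LinearMap.mulRight K (letter K (n + 1)))

theorem mem_pivotCoeff_add_two {n : ℕ} {f : GrassmannAlg K} : f ∈ pivotCoeff K (n + 2) ↔
    ∃ a ∈ below K (n + 1), ∃ b ∈ secondTypeCoeff K n, f = a + b * letter K (n + 1) := by
  rw [pivotCoeff, Submodule.mem_sup]
  constructor
  · rintro ⟨a, ha, _, ⟨b, hb, rfl⟩, rfl⟩
    exact ⟨a, ha, b, hb, rfl⟩
  · rintro ⟨a, ha, b, hb, rfl⟩
    exact ⟨a, ha, _, ⟨b, hb, rfl⟩, rfl⟩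

theorem below_le_pivotCoeff (n : ℕ) : below K (n - 1) ≤ pivotCoeff K n :=
  match n with
  | 0 => le_rfl
  | 1 => le_rfl
  | _ + 2 => le_sup_left

theorem pivotCoeff_le_below (n : ℕ) : pivotCoeff K n ≤ below K n :=
  match n with
  | 0 => le_rfl
  | 1 => below_mono zero_le_one
  | n + 2 => by
    intro f hf
    obtain ⟨a, ha, b, hb, rfl⟩ := mem_pivotCoeff_add_two.1 hf
    exact add_mem (below_le (by omega) ha)
      (mul_letter_mem_below (below_le (by omega) (secondTypeCoeff_le n hb)))

theorem parityProj_mem_pivotCoeff (p : ZMod 2) {n : ℕ} {f : GrassmannAlg K}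
    (hf : f ∈ pivotCoeff K n) : parityProj K p f ∈ pivotCoeff K n :=
  match n with
  | 0 => parityProj_mem_below p hf
  | 1 => parityProj_mem_below (n := 0) p hf
  | n + 2 => by
    obtain ⟨a, ha, b, hb, rfl⟩ := mem_pivotCoeff_add_two.1 hf
    have : parityProj K p (b * letter K (n + 1)) = parityProj K (p - 1) b * letter K (n + 1) := by
      rw [← parityProj_mul_of_mem (letter_mem_parity (n + 1)), sub_add_cancel]
    rw [map_add, this]
    exact mem_pivotCoeff_add_two.2
      ⟨_, parityProj_mem_below p ha, _, parityProj_mem_below _ hb, rfl⟩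

/-- The span of all `f v_n` with `f` a (homogeneous) element of `pivotCoeff K n`. -/
noncomputable def pivotSpan (K : Type*) [Field K] : Submodule K (Module.End K (GrassmannAlg K)) :=
  Submodule.span K
    {φ | ∃ (n : ℕ) (p : ZMod 2), ∃ f ∈ pivotCoeff K n, f ∈ parity K p ∧ φ = coeffPivot f n}

theorem coeffPivot_mem_pivotSpan {n : ℕ} {f : GrassmannAlg K} (hf : f ∈ pivotCoeff K n) :
    coeffPivot f n ∈ pivotSpan K := by
  rw [← parityProj_add_parityProj f, coeffPivot_add]
  exact add_mem
    (Submodule.subset_span ⟨n, 0, _, parityProj_mem_pivotCoeff 0 hf, parityProj_mem 0 f, rfl⟩)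
    (Submodule.subset_span ⟨n, 1, _, parityProj_mem_pivotCoeff 1 hf, parityProj_mem 1 f, rfl⟩)

/-- For `g = a + b x_{k+1}` the last letter survives only in `f v_n(b) x_{k+1}`. If `v_n(b) ≠ 0`,
then `n < k` and the characteristic is not 2, so the new coefficient is again admissible. -/
theorem mul_pivot_mem_pivotCoeff {n m : ℕ} (hnm : n ≤ m) {f g : GrassmannAlg K}
    (hf : f ∈ pivotCoeff K n) (hg : g ∈ pivotCoeff K m) :
    f * pivot K n g ∈ pivotCoeff K m := by
  have hf' := pivotCoeff_le_below n hf
  have h0 (h : pivot K n g = 0) : f * pivot K n g ∈ pivotCoeff K m := by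
    rw [h, mul_zero]
    exact zero_mem _
  obtain rfl | hlt := hnm.eq_or_lt
  · exact h0 (pivot_eq_zero_of_mem_below le_rfl (pivotCoeff_le_below n hg))
  match m with
  | 0 => omega
  | 1 => exact h0 (pivot_eq_zero_of_mem_below n.zero_le hg)
  | k + 2 =>
    obtain ⟨a, ha, b, hb, rfl⟩ := mem_pivotCoeff_add_two.1 hg
    have hb' := secondTypeCoeff_le k hb
    replace hf' : f ∈ below K (k + 1) := below_le (by omega) hf'
    refine mem_pivotCoeff_add_two.2 ⟨f * pivot K n a + f * (parityAut K b *
      pivot K n (letter K (k + 1))), ?_, f * pivot K n b, ?_, ?_⟩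
    · exact add_mem (mul_mem_below hf' (pivot_mem_below n ha)) (mul_mem_below hf'
        (mul_mem_below (below_le k.le_succ (parityAut_mem_below hb')) (pivot_letter_mem_below _ _)))
    · by_cases hz : pivot K n b = 0
      · rw [hz, mul_zero]
        exact zero_mem _
      · have hnk : n < k := by
          by_contra hcon
          exact hz (pivot_eq_zero_of_mem_below (by omega) hb')
        have h2 : ¬ (2 : K) = 0 := by
          intro h2
          rw [secondTypeCoeff, if_pos h2] at hb
          exact hz (pivot_eq_zero_of_mem_below n.zero_le hb)
        rw [secondTypeCoeff, if_neg h2]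
        exact mul_mem_below (below_le hnk.le (pivotCoeff_le_below n hf)) (pivot_mem_below n hb')
    · rw [map_add, pivot_mul]
      simp only [mul_add, mul_assoc]
      abel

/-- An odd index difference gives first type coefficients. An even one gives second type
coefficients with factor 2, so in characteristic 2 only zero. -/
theorem mulLeft_pivotAnticomm_mem_pivotSpan {n m : ℕ} (hnm : n ≤ m) {f : GrassmannAlg K}
    (hf : f ∈ below K m) : LinearMap.mulLeft K f * pivotAnticomm n m ∈ pivotSpan K := by
  obtain ⟨k, rfl | rfl⟩ : ∃ k, m = n + 2 * k ∨ m = n + 2 * k + 1 := ⟨(m - n) / 2, by omega⟩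
  · rw [mulLeft_pivotAnticomm_even]
    by_cases h2 : (2 : K) = 0
    · rw [h2, zero_smul, coeffPivot_zero]
      exact zero_mem _
    · rw [coeffPivot_smul]
      refine Submodule.smul_mem _ _ (coeffPivot_mem_pivotSpan
        (mem_pivotCoeff_add_two.2 ⟨0, zero_mem _, _, ?_, (zero_add _).symm⟩))
      rw [secondTypeCoeff, if_neg h2]
      exact mul_mem_below hf (monomial_Ico_mem_below _ _)
  · rw [mulLeft_pivotAnticomm_odd]
    exact coeffPivot_mem_pivotSpan (below_le_pivotCoeff _
      (neg_mem (mul_mem_below hf (monomial_Ico_mem_below _ _))))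

theorem superBracket_coeffPivot_mem_pivotSpan {n m : ℕ} (hnm : n ≤ m) {f g : GrassmannAlg K}
    (hf : f ∈ pivotCoeff K n) (hg : g ∈ pivotCoeff K m) :
    superBracket (coeffPivot f n) (coeffPivot g m) ∈ pivotSpan K := by
  have hf' := pivotCoeff_le_below n hf
  rw [superBracket_coeffPivot hnm hf']
  exact add_mem (coeffPivot_mem_pivotSpan (mul_pivot_mem_pivotCoeff hnm hf hg))
    (mulLeft_pivotAnticomm_mem_pivotSpan hnm (mul_mem_below (below_le hnm hf')
      (parityAut_mem_below (pivotCoeff_le_below m hg))))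

theorem superBracket_mem_pivotSpan {φ ψ : Module.End K (GrassmannAlg K)} (hφ : φ ∈ pivotSpan K)
    (hψ : ψ ∈ pivotSpan K) : superBracket φ ψ ∈ pivotSpan K := by
  induction hφ using Submodule.span_induction with
  | zero =>
    rw [superBracket_zero_left]
    exact zero_mem _
  | add φ φ' _ _ h h' =>
    rw [superBracket_add_left]
    exact add_mem h h'
  | smul c φ _ h =>
    rw [superBracket_smul_left]
    exact Submodule.smul_mem _ _ h
  | mem φ hφ =>
    induction hψ using Submodule.span_induction with
    | zero =>
      rw [superBracket_zero_right]
      exact zero_mem _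
    | add ψ ψ' _ _ h h' =>
      rw [superBracket_add_right]
      exact add_mem h h'
    | smul c ψ _ h =>
      rw [superBracket_smul_right]
      exact Submodule.smul_mem _ _ h
    | mem ψ hψ =>
      obtain ⟨n, p, f, hf, hfp, rfl⟩ := hφ
      obtain ⟨m, q, g, hg, hgq, rfl⟩ := hψ
      obtain hnm | hmn := le_total n m
      · exact superBracket_coeffPivot_mem_pivotSpan hnm hf hg
      · have := superBracket_coeffPivot_mem_pivotSpan hmn hg hf
        obtain h | h := superBracket_swap (coeffPivot_mem_endParity hgq m)
          (coeffPivot_mem_endParity hfp n)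
        · rwa [h]
        · rw [h]
          exact neg_mem this

theorem endPart_mem_pivotSpan (i : ZMod 2) {φ : Module.End K (GrassmannAlg K)}
    (hφ : φ ∈ pivotSpan K) : endPart i φ ∈ pivotSpan K := by
  induction hφ using Submodule.span_induction with
  | zero => simp [endPart]
  | add φ ψ _ _ h h' =>
    rw [endPart_add]
    exact add_mem h h'
  | smul c φ _ h =>
    rw [endPart_smul]
    exact Submodule.smul_mem _ _ h
  | mem φ hφ =>
    obtain ⟨n, p, f, hf, hfp, rfl⟩ := hφ
    rw [endPart_of_mem (coeffPivot_mem_endParity hfp n)]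
    split_ifs
    · exact coeffPivot_mem_pivotSpan hf
    · exact zero_mem _

/-! ### Characteristic 2: closure under squares -/

theorem add_self_eq_zero_of_two_eq_zero {M : Type*} [AddCommGroup M] [Module K M]
    (h2 : (2 : K) = 0) (x : M) : x + x = 0 := by
  rw [← two_smul K, h2, zero_smul]

theorem neg_eq_of_two_eq_zero {M : Type*} [AddCommGroup M] [Module K M]
    (h2 : (2 : K) = 0) (x : M) : -x = x :=
  neg_eq_of_add_eq_zero_left (add_self_eq_zero_of_two_eq_zero h2 x)

theorem parityAut_of_two_eq_zero (h2 : (2 : K) = 0) (f : GrassmannAlg K) :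
    parityAut K f = f := by
  rw [← parityProj_add_parityProj f, map_add, parityAut_of_even (parityProj_mem 0 f),
    parityAut_of_odd (parityProj_mem 1 f), neg_eq_of_two_eq_zero h2]

theorem mul_comm_of_two_eq_zero (h2 : (2 : K) = 0) (f g : GrassmannAlg K) : f * g = g * f := by
  rw [← parityProj_add_parityProj f, add_mul, mul_add, even_mul_comm (parityProj_mem 0 f),
    odd_mul_comm (parityProj_mem 1 f), parityAut_of_two_eq_zero h2]

/-- In characteristic 2 the algebra `Λ` is commutative, cross terms cancel and letters square to
zero, so `f²` is the square of the constant term. This is why only `x_{n-1} v_n` is needed as second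
type monomial. -/
theorem mul_self_mem_below_zero (h2 : (2 : K) = 0) {n : ℕ} {f : GrassmannAlg K}
    (hf : f ∈ below K n) : f * f ∈ below K 0 := by
  induction n generalizing f with
  | zero => exact mul_mem_below hf hf
  | succ n ih =>
    obtain ⟨a, ha, b, hb, rfl⟩ := mem_below_succ.1 hf
    have h : (a + b * letter K n) * (a + b * letter K n) = a * a := by
      rw [add_mul, mul_add, mul_add, mul_comm_of_two_eq_zero h2 (b * letter K n) a, add_assoc,
        ← add_assoc (a * (b * letter K n)), add_self_eq_zero_of_two_eq_zero h2, mul_assoc b,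
        ← mul_assoc (letter K n), letter_mul_mul_letter]
      simp
    rw [h]
    exact ih ha

theorem coeffPivot_mul_self {n : ℕ} {f : GrassmannAlg K} (hf : f ∈ below K n) :
    coeffPivot f n * coeffPivot f n =
      coeffPivot (f * parityAut K f * letter K (n + 1)) (n + 2) := by
  refine LinearMap.ext fun y => ?_
  rw [Module.End.mul_apply, coeffPivot_apply, coeffPivot_apply, pivot_mul,
    pivot_eq_zero_of_mem_below le_rfl hf, pivot_pivot_self, coeffPivot_apply]
  simp only [zero_mul, zero_add, mul_assoc]

theorem endPart_mem_endParity (i : ZMod 2) (φ : Module.End K (GrassmannAlg K)) :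
    endPart i φ ∈ endParity K i := by
  refine sum_mem fun j _ k a ha => ?_
  rw [Module.End.mul_apply, Module.End.mul_apply, parityProj_of_mem ha]
  split_ifs with h
  · subst h
    exact parityProj_mem _ _
  · rw [map_zero, map_zero]
    exact zero_mem _

theorem endPart_add_endPart (φ : Module.End K (GrassmannAlg K)) :
    endPart 0 φ + endPart 1 φ = φ := by
  refine LinearMap.ext fun f => ?_
  have h (g : GrassmannAlg K) : ∑ i, ∑ j, parityProj K (i + j) (φ (parityProj K j g)) = φ g := by
    rw [Finset.sum_comm]
    conv_rhs => rw [← sum_parityProj g, map_sum]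
    refine Finset.sum_congr rfl fun j _ => ?_
    conv_rhs => rw [← sum_parityProj (φ _)]
    exact Equiv.sum_comp (Equiv.addRight j) fun k => parityProj K k (φ (parityProj K j g))
  have h' := h f
  rw [show (∑ i : ZMod 2, ∑ j, parityProj K (i + j) (φ (parityProj K j f))) =
    (∑ j, parityProj K (0 + j) (φ (parityProj K j f))) +
      ∑ j, parityProj K (1 + j) (φ (parityProj K j f)) from
    Fin.sum_univ_two fun i : Fin 2 => ∑ j : ZMod 2,
      parityProj K ((show ZMod 2 from i) + j) (φ (parityProj K j f))] at h'
  simpa only [endPart, LinearMap.add_apply, LinearMap.sum_apply, Module.End.mul_apply] using h'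

theorem superBracket_of_two_eq_zero (h2 : (2 : K) = 0) (φ ψ : Module.End K (GrassmannAlg K)) :
    superBracket φ ψ = φ * ψ + ψ * φ := by
  have key (i j : ZMod 2) : superBracket (endPart i φ) (endPart j ψ) =
      endPart i φ * endPart j ψ + endPart j ψ * endPart i φ := by
    by_cases hij : i * j = 0
    · rw [superBracket_of_mem_of_mul_eq_zero (endPart_mem_endParity i φ)
        (endPart_mem_endParity j ψ) hij, sub_eq_add_neg, neg_eq_of_two_eq_zero h2]
    · obtain ⟨rfl, rfl⟩ : i = 1 ∧ j = 1 :=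
        (by decide : ∀ a b : ZMod 2, a * b ≠ 0 → a = 1 ∧ b = 1) i j hij
      exact superBracket_of_mem_odd (endPart_mem_endParity _ φ) (endPart_mem_endParity _ ψ)
  rw [← endPart_add_endPart φ, ← endPart_add_endPart ψ]
  simp only [superBracket_add_left, superBracket_add_right, key, mul_add, add_mul]
  abel

/-- The square of a sum differs from the sum of squares by a supercommutator, so it suffices to
square the generators. -/
theorem mul_self_mem_pivotSpan (h2 : (2 : K) = 0) {φ : Module.End K (GrassmannAlg K)}
    (hφ : φ ∈ pivotSpan K) : φ * φ ∈ pivotSpan K := by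
  induction hφ using Submodule.span_induction with
  | zero =>
    rw [mul_zero]
    exact zero_mem _
  | add φ ψ hφ hψ h h' =>
    have := superBracket_mem_pivotSpan hφ hψ
    rw [superBracket_of_two_eq_zero h2] at this
    have e : (φ + ψ) * (φ + ψ) = φ * φ + (φ * ψ + ψ * φ) + ψ * ψ := by
      rw [add_mul, mul_add, mul_add]
      abel
    rw [e]
    exact add_mem (add_mem h this) h'
  | smul c φ _ h =>
    rw [smul_mul_smul_comm]
    exact Submodule.smul_mem _ _ h
  | mem φ hφ =>
    obtain ⟨n, p, f, hf, -, rfl⟩ := hφ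
    have hf' := pivotCoeff_le_below n hf
    rw [coeffPivot_mul_self hf', parityAut_of_two_eq_zero h2]
    refine coeffPivot_mem_pivotSpan
      (mem_pivotCoeff_add_two.2 ⟨0, zero_mem _, _, ?_, (zero_add _).symm⟩)
    rw [secondTypeCoeff, if_pos h2]
    exact mul_self_mem_below_zero h2 hf'

theorem isLieSubsuperalgebra_pivotSpan : IsLieSubsuperalgebra (pivotSpan K) where
  graded i _ hφ := endPart_mem_pivotSpan i hφ
  bracket_mem _ hφ _ hψ := superBracket_mem_pivotSpan hφ hψ
  sq_mem h2 _ hφ _ := mul_self_mem_pivotSpan h2 hφ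

theorem pivotLie_le_pivotSpan : pivotLie K ≤ pivotSpan K := by
  have h (n : ℕ) : pivot K n ∈ pivotSpan K := by
    rw [← coeffPivot_one]
    exact coeffPivot_mem_pivotSpan (below_le_pivotCoeff n (one_mem_below _))
  refine sInf_le ⟨isLieSubsuperalgebra_pivotSpan, ?_⟩
  rintro φ (rfl | rfl)
  · exact h 0
  · exact h 1

/-! ### Ideals -/

/-- Elements `a` of the span of the `f v_n` satisfy `[a, f x_p v_m] = a(f x_p) v_m` for `p < m`
large and `f` in the first `p` letters. -/
theorem exists_superBracket_eq_of_mem_pivotSpan {a : Module.End K (GrassmannAlg K)}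
    (ha : a ∈ pivotSpan K) : ∃ N, ∀ p, N ≤ p → ∀ f ∈ below K p, a f ∈ below K p ∧
      a (f * letter K p) - a f * letter K p ∈ below K p ∧
      ∀ m, p < m → superBracket a (coeffPivot (f * letter K p) m) =
        coeffPivot (a (f * letter K p)) m := by
  induction ha using Submodule.span_induction with
  | zero =>
    refine ⟨0, fun p _ f _ => ⟨zero_mem _, by simp, fun m _ => ?_⟩⟩
    rw [superBracket_zero_left, LinearMap.zero_apply, coeffPivot_zero]
  | add a b _ _ iha ihb =>
    obtain ⟨N₁, h₁⟩ := iha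
    obtain ⟨N₂, h₂⟩ := ihb
    refine ⟨max N₁ N₂, fun p hp f hf => ?_⟩
    obtain ⟨h11, h12, h13⟩ := h₁ p (by omega) f hf
    obtain ⟨h21, h22, h23⟩ := h₂ p (by omega) f hf
    refine ⟨add_mem h11 h21, ?_, fun m hm => ?_⟩
    · rw [LinearMap.add_apply, LinearMap.add_apply, add_mul, add_sub_add_comm]
      exact add_mem h12 h22
    · rw [superBracket_add_left, h13 m hm, h23 m hm, LinearMap.add_apply, coeffPivot_add]
  | smul c a _ iha =>
    obtain ⟨N, h⟩ := iha
    refine ⟨N, fun p hp f hf => ?_⟩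
    obtain ⟨h1, h2, h3⟩ := h p hp f hf
    refine ⟨Submodule.smul_mem _ c h1, ?_, fun m hm => ?_⟩
    · rw [LinearMap.smul_apply, LinearMap.smul_apply, smul_mul_assoc, ← smul_sub]
      exact Submodule.smul_mem _ c h2
    · rw [superBracket_smul_left, h3 m hm, LinearMap.smul_apply, coeffPivot_smul]
  | mem a ha =>
    obtain ⟨n, -, g, hg, -, rfl⟩ := ha
    replace hg := pivotCoeff_le_below n hg
    -- For a generator `g v_n` the bound is `n`: the Leibniz rule gives `a(f x_p) = a(f) x_p` plus
    -- terms free of `x_p`. This congruence later shows that the coefficient is nonzero.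
    refine ⟨n, fun p hp f hf => ⟨?_, ?_, fun m hm => ?_⟩⟩
    · exact mul_mem_below (below_le hp hg) (pivot_mem_below n hf)
    · rw [coeffPivot_apply, coeffPivot_apply, pivot_mul, mul_add, mul_assoc, add_sub_cancel_left]
      exact mul_mem_below (below_le hp hg)
        (mul_mem_below (parityAut_mem_below hf) (pivot_letter_mem_below n p))
    · rw [superBracket_coeffPivot_mul_letter hp hm hg, coeffPivot_apply]

variable {J : Submodule K (Module.End K (GrassmannAlg K))}

theorem IsLieIdeal.exists_coeffPivot_mem (hJ : IsLieIdeal (pivotLie K) J) (hJ0 : J ≠ ⊥) :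
    ∃ N, ∀ m, N ≤ m → ∃ h ∈ below K m, h ≠ 0 ∧ coeffPivot h m ∈ J := by
  obtain ⟨a, haJ, ha0⟩ := Submodule.exists_mem_ne_zero_of_ne_bot hJ0
  obtain ⟨N, hN⟩ := exists_superBracket_eq_of_mem_pivotSpan (pivotLie_le_pivotSpan (hJ.le haJ))
  obtain ⟨f, hf⟩ : ∃ f, a f ≠ 0 := by
    by_contra! hcon
    exact ha0 (LinearMap.ext hcon)
  obtain ⟨k, hk⟩ := exists_mem_below f
  have hfp : f ∈ below K (max N k) := below_le (le_max_right _ _) hk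
  obtain ⟨h1, h2, h3⟩ := hN _ (le_max_left _ _) f hfp
  generalize max N k = p at *
  -- From `m ≥ p + 2` on, `f x_p v_m` is of the first type and hence lies in `R`.
  refine ⟨p + 2, fun m hm => ⟨a (f * letter K p), ?_, ?_, ?_⟩⟩
  · rw [← sub_add_cancel (a (f * letter K p)) (a f * letter K p)]
    exact below_le (show p + 1 ≤ m by omega)
      (add_mem (below_le p.le_succ h2) (mul_letter_mem_below h1))
  -- If `a(f x_p)` vanished, `a(f) x_p` would be free of `x_p`; applying `∂_p` would give `α(a(f)) =
  -- 0`.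
  · intro h0
    rw [h0, zero_sub, neg_mem_iff] at h2
    have := partialD_eq_zero_of_mem_below le_rfl h2
    rw [partialD_mul, partialD_eq_zero_of_mem_below le_rfl h1, partialD_letter, if_pos rfl,
      zero_mul, zero_add, mul_one] at this
    exact hf (parityAut_injective (this.trans (map_zero _).symm))
  · rw [← h3 m (by omega)]
    refine hJ.bracket_right_mem _ (coeffPivot_mem_pivotLie ?_) _ haJ
    exact below_le (show p + 1 ≤ m - 1 by omega) (mul_letter_mem_below hfp)

theorem partialD_monomial_Ico (i m : ℕ) :
    partialD K i (monomial K (Finset.Ico (i + 1) m)) = 0 := by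
  induction m with
  | zero => simp
  | succ m ih =>
    obtain h | h := lt_or_ge m (i + 1)
    · rw [Finset.Ico_eq_empty (by omega), monomial_empty, partialD_one]
    · rw [monomial_Ico_succ_right h, partialD_mul, ih, partialD_letter, if_neg (by omega)]
      simp

theorem IsLieIdeal.exists_pivot_mem (hJ : IsLieIdeal (pivotLie K) J) (hJ0 : J ≠ ⊥) :
    ∃ N, ∀ m, N ≤ m → pivot K m ∈ J := by
  obtain ⟨N, hN⟩ := hJ.exists_coeffPivot_mem hJ0
  refine ⟨N + 2, fun M hM => ?_⟩
  obtain ⟨m, rfl⟩ : ∃ m, M = m + 2 := ⟨M - 2, by omega⟩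
  obtain ⟨h, hh, h0, hhJ⟩ := hN m (by omega)
  obtain ⟨g, hg, hhg⟩ := exists_mul_eq_monomial m hh h0
  -- The top product `x_0 ⋯ x_{m-1}` is reached by a bracket with `x_m g v_{m+2}`; then `v_0, v_1,
  -- …` remove its letters one at a time from the left.
  have key : ∀ i ≤ m, coeffPivot (monomial K (Finset.Ico i m)) (m + 2) ∈ J := by
    intro i
    induction i with
    | zero =>
      intro _
      rw [← hhg, ← superBracket_coeffPivot_letter_mul (by omega) hh
        (partialD_eq_zero_of_mem_below le_rfl hg)]
      exact hJ.bracket_right_mem _ (coeffPivot_mem_pivotLie (letter_mul_mem_below hg)) _ hhJ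
    | succ i ih =>
      intro hi
      have := hJ.bracket_left_mem _ (pivot_mem_pivotLie i) _ (ih (by omega))
      rwa [monomial_Ico_succ_left (by omega),
        superBracket_pivot_letter_mul (by omega) (partialD_monomial_Ico i m)] at this
  simpa using key m le_rfl

/-! ### From pivots in the ideal to all long monomials -/

theorem IsLieIdeal.coeffPivot_mem (hJ : IsLieIdeal (pivotLie K) J) {n : ℕ} (hn : pivot K n ∈ J)
    {f : GrassmannAlg K} (hf : f ∈ below K (n + 1)) : coeffPivot f (n + 2) ∈ J := by
  refine coeffPivot_mem_of_superBracket_mem (fun g hg => ?_) (fun φ hφ => ?_) hf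
  · exact hJ.bracket_right_mem _ (coeffPivot_mem_pivotLie (n := n + 1) hg) _ hn
  · exact hJ.bracket_right_mem _ (hJ.le hφ) _ hn

/-- The coefficient is split by `x_{n+1}` and `x_n`. Parts free of `x_{n+1}` come from `[g v_{n+2},
v_{n+2}]`, those with `x_n x_{n+1}` from `[v_n, α(g) v_{n+2}]`, and those with `x_{n+1}` alone by
stripping `x_n` from the latter. The factor 2 must be invertible. -/
theorem IsLieIdeal.coeffPivot_mul_letter_mem_of_two_ne_zero (hJ : IsLieIdeal (pivotLie K) J)
    (h2 : ¬ (2 : K) = 0) {n : ℕ} (hn : ∀ g ∈ below K (n + 1), coeffPivot g (n + 2) ∈ J)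
    {f : GrassmannAlg K} (hf : f ∈ below K (n + 2)) :
    coeffPivot (f * letter K (n + 3)) (n + 4) ∈ J := by
  have h1 : ∀ g ∈ below K (n + 1), coeffPivot (g * letter K (n + 3)) (n + 4) ∈ J := by
    intro g hg
    have := hJ.bracket_right_mem _ (pivot_mem_pivotLie (n + 2)) _ (hn g hg)
    rw [← coeffPivot_one, superBracket_coeffPivot le_rfl (below_le (n + 1).le_succ hg), pivot_one,
      mul_zero, coeffPivot_zero, zero_add, map_one, mul_one] at this
    have e := mulLeft_pivotAnticomm_even g 0 (n + 2)
    simp only [mul_zero, add_zero] at e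
    rwa [e, coeffPivot_smul, Submodule.smul_mem_iff _ h2, Finset.Ico_self, monomial_empty,
      mul_one] at this
  have h3 : ∀ g ∈ below K n,
      coeffPivot (g * letter K n * letter K (n + 1) * letter K (n + 3)) (n + 4) ∈ J := by
    intro g hg
    have hg' := parityAut_mem_below hg
    have := hJ.bracket_left_mem _ (pivot_mem_pivotLie n) _ (hn _ (below_le n.le_succ hg'))
    have e := mulLeft_pivotAnticomm_even g 1 n
    rw [mul_one] at e
    rwa [superBracket_pivot_coeffPivot (by omega), pivot_eq_zero_of_mem_below le_rfl hg',
      coeffPivot_zero, zero_add, parityAut_parityAut, e, coeffPivot_smul,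
      Submodule.smul_mem_iff _ h2, monomial_Ico_succ_right (by omega),
      monomial_Ico_succ_right le_rfl, Finset.Ico_self, monomial_empty, one_mul, ← mul_assoc] at this
  have h4 : ∀ g ∈ below K n,
      coeffPivot (g * letter K (n + 1) * letter K (n + 3)) (n + 4) ∈ J := by
    intro g hg
    have := hJ.bracket_left_mem _ (pivot_mem_pivotLie n) _ (h3 _ (parityAut_mem_below hg))
    rwa [← letter_mul_eq, mul_assoc, mul_assoc, superBracket_pivot_letter_mul (by omega),
      ← mul_assoc] at this
    simp [partialD_mul, partialD_letter, partialD_eq_zero_of_mem_below le_rfl hg]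
  obtain ⟨a, ha, b, hb, rfl⟩ := mem_below_succ.1 hf
  obtain ⟨c, hc, d, hd, rfl⟩ := mem_below_succ.1 hb
  rw [add_mul, add_mul, add_mul, coeffPivot_add, coeffPivot_add]
  exact add_mem (h1 a ha) (add_mem (h4 c hc) (h3 d hd))

theorem IsLieIdeal.coeffPivot_mul_letter_mem (hJ : IsLieIdeal (pivotLie K) J) {n : ℕ}
    (hn : pivot K n ∈ J) (hn' : pivot K (n + 2) ∈ J) {f : GrassmannAlg K}
    (hf : f ∈ secondTypeCoeff K (n + 2)) : coeffPivot (f * letter K (n + 3)) (n + 4) ∈ J := by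
  by_cases h2 : (2 : K) = 0
  · rw [secondTypeCoeff, if_pos h2, mem_below_zero] at hf
    obtain ⟨c, rfl⟩ := hf
    rw [smul_mul_assoc, one_mul, coeffPivot_smul, ← pivot_mul_pivot]
    exact Submodule.smul_mem _ _ (hJ.sq_mem h2 _ hn' (pivot_mem_endParity _))
  · rw [secondTypeCoeff, if_neg h2] at hf
    exact hJ.coeffPivot_mul_letter_mem_of_two_ne_zero h2 (fun g hg => hJ.coeffPivot_mem hn hg) hf

theorem IsLieIdeal.coeffPivot_mem_of_mem_pivotCoeff (hJ : IsLieIdeal (pivotLie K) J) {n : ℕ}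
    (hn : pivot K n ∈ J) (hn' : pivot K (n + 2) ∈ J) {f : GrassmannAlg K}
    (hf : f ∈ pivotCoeff K (n + 4)) : coeffPivot f (n + 4) ∈ J := by
  obtain ⟨a, ha, b, hb, rfl⟩ := mem_pivotCoeff_add_two.1 hf
  rw [coeffPivot_add]
  exact add_mem (hJ.coeffPivot_mem hn' ha) (hJ.coeffPivot_mul_letter_mem hn hn' hb)

/-! ### Basis monomials, finite codimension and infinite dimension -/

theorem basisMonomials_subset (n : ℕ) {φ : Module.End K (GrassmannAlg K)}
    (hφ : φ ∈ basisMonomials K n) : ∃ f ∈ pivotCoeff K n, φ = coeffPivot f n := by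
  obtain ⟨S, hS, rfl⟩ | ⟨hn, S, hS, -, hS2, rfl⟩ := hφ
  · exact ⟨_, below_le_pivotCoeff n (monomial_mem_below hS), monomialPivot_eq S n⟩
  · obtain ⟨k, rfl⟩ : ∃ k, n = k + 2 := ⟨n - 2, by omega⟩
    refine ⟨_, ?_, monomialPivot_eq _ _⟩
    have hmax : monomial K (insert (k + 2 - 1) S) = monomial K S * letter K (k + 1) :=
      monomial_insert_max fun b hb => by
        have := Finset.mem_range.1 (hS hb)
        omega
    rw [hmax]
    refine mem_pivotCoeff_add_two.2 ⟨0, zero_mem _, _, ?_, (zero_add _).symm⟩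
    rw [secondTypeCoeff]
    split_ifs with h2
    · rw [hS2 h2, monomial_empty]
      exact one_mem_below 0
    · exact monomial_mem_below hS

/-- The quotient `L / (L ∩ J)` embeds into `V / J` with image inside that of `F`. -/
theorem hasFiniteCodim_of_le_sup {V : Type*} [AddCommGroup V] [Module K V]
    {L F J : Submodule K V} [FiniteDimensional K F] (h : L ≤ F ⊔ J) : HasFiniteCodim L J := by
  have hker : LinearMap.ker (J.mkQ ∘ₗ L.subtype) = J.submoduleOf L := by
    rw [LinearMap.ker_comp, Submodule.ker_mkQ]
    rfl
  have hrange : LinearMap.range (J.mkQ ∘ₗ L.subtype) ≤ F.map J.mkQ := by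
    rw [LinearMap.range_comp, Submodule.range_subtype]
    refine (Submodule.map_mono h).trans ?_
    rw [Submodule.map_sup, Submodule.mkQ_map_self, sup_bot_eq]
  have : FiniteDimensional K (LinearMap.range (J.mkQ ∘ₗ L.subtype)) :=
    Submodule.finiteDimensional_of_le hrange
  unfold HasFiniteCodim
  rw [← hker]
  exact Module.Finite.equiv (J.mkQ ∘ₗ L.subtype).quotKerEquivRange.symm

/-- The linear map `f ↦ f v_n`. -/
noncomputable def coeffPivotHom (n : ℕ) : GrassmannAlg K →ₗ[K] Module.End K (GrassmannAlg K) where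
  toFun f := coeffPivot f n
  map_add' f g := coeffPivot_add f g n
  map_smul' a f := coeffPivot_smul a f n

theorem hasFiniteCodim_of_coeffPivot_mem {N : ℕ}
    (hN : ∀ n, N ≤ n → ∀ f ∈ pivotCoeff K n, coeffPivot f n ∈ J) :
    HasFiniteCodim (pivotLie K) J := by
  have hle : pivotLie K ≤ (Finset.range N).sup (fun n => (below K n).map (coeffPivotHom n)) ⊔ J := by
    refine pivotLie_le_pivotSpan.trans (Submodule.span_le.2 ?_)
    rintro _ ⟨n, -, f, hf, -, rfl⟩
    obtain hn | hn := lt_or_ge n N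
    · refine Submodule.mem_sup_left ?_
      exact Finset.le_sup (f := fun n => (below K n).map (coeffPivotHom n)) (Finset.mem_range.2 hn)
        ⟨f, pivotCoeff_le_below n hf, rfl⟩
    · exact Submodule.mem_sup_right (hN n hn f hf)
  have hF : FiniteDimensional K ((Finset.range N).sup fun n =>
      (below K n).map (coeffPivotHom n) : Submodule K (Module.End K (GrassmannAlg K))) :=
    Submodule.finiteDimensional_finset_sup _ _
  exact hasFiniteCodim_of_le_sup hle

/-- The constant term of `v_n(x_k)` is `δ_{nk}`, since every later term of `v_n` starts with a
letter. -/
theorem linearIndependent_pivot : LinearIndependent K (pivot K) := by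
  let e : Module.End K (GrassmannAlg K) →ₗ[K] ℕ → K :=
    LinearMap.pi fun k => (ExteriorAlgebra.algebraMapInv (R := K) (M := ℕ →₀ K)).toLinearMap ∘ₗ
      LinearMap.applyₗ (letter K k)
  refine LinearIndependent.of_comp e ?_
  have h : e ∘ pivot K = fun n => Pi.single n 1 := by
    funext n k
    change ExteriorAlgebra.algebraMapInv (pivot K n (letter K k)) = _
    have hl (i : ℕ) : ExteriorAlgebra.algebraMapInv (letter K i) = 0 := by
      simp [letter, ExteriorAlgebra.algebraMapInv]
    rw [pivot_apply, map_add, map_mul, hl, zero_mul, add_zero, partialD_letter, Pi.single_apply,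
      apply_ite ExteriorAlgebra.algebraMapInv, map_one, map_zero]
    simp only [eq_comm]
  rw [h]
  exact Pi.linearIndependent_single_one ℕ K

theorem not_finiteDimensional_pivotLie : ¬ FiniteDimensional K (pivotLie K) := by
  intro hfin
  have : LinearIndependent K fun n => (⟨pivot K n, pivot_mem_pivotLie n⟩ : pivotLie K) :=
    LinearIndependent.of_comp (pivotLie K).subtype linearIndependent_pivot
  exact Set.infinite_univ (Set.finite_univ_iff.2 (this.finite))

theorem IsLieIdeal.exists_coeffPivot_mem_of_mem_pivotCoeff (hJ : IsLieIdeal (pivotLie K) J)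
    (hJ0 : J ≠ ⊥) : ∃ N, ∀ n, N + 6 ≤ n → ∀ f ∈ pivotCoeff K n, coeffPivot f n ∈ J := by
  obtain ⟨N, hN⟩ := hJ.exists_pivot_mem hJ0
  refine ⟨N, fun n hn f hf => ?_⟩
  -- Length `k + 4` requires `v_k` and `v_{k+2}` in `J`; already `k ≥ N` suffices, so the 6 leaves
  -- slack.
  obtain ⟨k, rfl⟩ : ∃ k, n = k + 4 := ⟨n - 4, by omega⟩
  exact hJ.coeffPivot_mem_of_mem_pivotCoeff (hN k (by omega)) (hN (k + 2) (by omega)) hf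

end GrassmannAlg

theorem theorem11p1 (K : Type*) [Field K] :
    GrassmannAlg.IsJustInfinite (GrassmannAlg.pivotLie K) ∧
      ∀ J : Submodule K (Module.End K (GrassmannAlg K)),
        GrassmannAlg.IsLieIdeal (GrassmannAlg.pivotLie K) J → J ≠ ⊥ →
          ∃ N : ℕ, ∀ n : ℕ, N + 6 ≤ n → GrassmannAlg.basisMonomials K n ⊆ J := by
  refine ⟨⟨GrassmannAlg.not_finiteDimensional_pivotLie, fun J hJ hJ0 => ?_⟩, fun J hJ hJ0 => ?_⟩
  · obtain ⟨N, hN⟩ := hJ.exists_coeffPivot_mem_of_mem_pivotCoeff hJ0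
    exact GrassmannAlg.hasFiniteCodim_of_coeffPivot_mem hN
  · obtain ⟨N, hN⟩ := hJ.exists_coeffPivot_mem_of_mem_pivotCoeff hJ0
    refine ⟨N, fun n hn φ hφ => ?_⟩
    obtain ⟨f, hf, rfl⟩ := GrassmannAlg.basisMonomials_subset n hφ
    exact hN n hn f hf
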